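/- Let $\alpha\in[0,1]$. Fix smooth $\chi^\pm:\mathbb R\to[0,1]$ with $\chi^++\chi^-=1$, $\operatorname{supp}\chi^+\subset(-1,\infty)$, $\operatorname{supp}\chi^-\subset(-\infty,1)$, and set $E_2=\{f+a\chi^++b\chi^-: f\in H^1(\mathbb R),\ a,b\in\mathbb R\}$, $E_1^0=\{f+a\chi^+: f\in L^2(\mathbb R),\ a\in\mathbb R\}$ (these do not depend on $\chi^\pm$). For a finite Borel measure $\mu$ on $\mathbb R$ let $\mu=\mu_{\rm ac}+\mu_{\rm sing}$ be its Lebesgue decomposition, $F(x)=\mu((-\infty,x))$, $F_{\rm ac}(x)=\mu_{\rm ac}((-\infty,x))$, $F_{\rm sing}(x)=\mu_{\rm sing}((-\infty,x))$. Let $\mathcal D$ be the set of triplets $(u,\mu,\nu)$ such that $u\in E_2$; $\mu\le\nu$ are finite positive Borel measures on $\mathbb R$ with $\mu_{\rm ac}\le\nu_{\rm ac}$; $d\mu_{\rm ac}=u_x^2\,dx$; $\mu((-\infty,\cdot)),\ \nu((-\infty,\cdot))\in E_1^0$; if $\alpha=1$, then $d\nu_{\rm ac}=d\mu=u_x^2\,dx$;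 if $\alpha<1$, then $\frac{d\mu}{d\nu}\in\{1-\alpha,1\}$ ($\nu$-a.e.), and $\frac{d\mu_{\rm ac}}{d\nu_{\rm ac}}(x)=1$ if $u_x(x)<0$ ($\nu_{\rm ac}$-a.e.). Let $\mathcal D_0=\{(u,\mu,\nu)\in\mathcal D:\mu=\nu\}$. Define $L(u,\mu,\nu)=(y,U,V,H)$ by $$y(\xi)=\sup\{x:\nu((-\infty,x))+x<\xi\},\quad U=u\circ y,\quad H(\xi)=\xi-y(\xi),\quad V(\xi)=\int_{-\infty}^\xi\frac{d\mu}{d\nu}(y(\eta))H_\xi(\eta)\,d\eta .$$ For $\Delta x>0$ let $x_j=j\Delta x$, $Df_{2j}=\frac{f(x_{2j+2})-f(x_{2j})}{2\Delta x}$, and, for $(u,\mu,\mu)\in\mathcal D_0$, $q_{2j}=\sqrt{DF_{{\rm ac},2j}-(Du_{2j})^2}$. Choose signs $s_{j}\in\{1,-1\}$, $j\in\mathbb Z$, arbitrarily (they may depend on $\Delta x$). The projection $P_{\Delta x}(u,\mu,\mu)=(u_{\Delta x},\mu_{\Delta x},\mu_{\Delta x})$ is given by $$u_{\Delta x}(x)=\begin{cases}u(x_{2j})+(Du_{2j}-s_jq_{2j})(x-x_{2j}),&x_{2j}<x\le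 x_{2j+1},\\ u(x_{2j+2})+(Du_{2j}+s_jq_{2j})(x-x_{2j+2}),&x_{2j+1}<x\le x_{2j+2},\end{cases}$$ and by $\mu_{\Delta x}((-\infty,x))=F_{\Delta x,{\rm ac}}(x)+F_{\Delta x,{\rm sing}}(x)$, where $F_{\Delta x,{\rm sing}}(x)=F_{\rm sing}(x_{2j+2})$ for $x_{2j}<x\le x_{2j+2}$ and $$F_{\Delta x,{\rm ac}}(x)=\begin{cases}F_{\rm ac}(x_{2j})+(Du_{2j}-s_jq_{2j})^2(x-x_{2j}),&x_{2j}<x\le x_{2j+1},\\ \tfrac12\big(F_{\rm ac}(x_{2j+2})+F_{\rm ac}(x_{2j})\big)-2s_jq_{2j}Du_{2j}\Delta x+(Du_{2j}+s_jq_{2j})^2(x-x_{2j+1}),&x_{2j+1}<x\le x_{2j+2}.\end{cases}$$ **Claim.** Let $(u,\mu,\nu)\in\mathcal D_0$, $X=(y,U,V,H)=L(u,\mu,\nu)$ and, for $\Delta x>0$, $X_{\Delta x}=(y_{\Delta x},U_{\Delta x},V_{\Delta x},H_{\Delta x})=L(P_{\Delta x}(u,\mu,\nu))$. Then $y,U,H$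 and $y_{\Delta x},U_{\Delta x},H_{\Delta x}$ are Lipschitz continuous, hence differentiable a.e.; $U_\xi,U_{\Delta x,\xi}\in L^2(\mathbb R)$ and $H_\xi,H_{\Delta x,\xi}\in L^1(\mathbb R)\cap L^2(\mathbb R)$; and, as $\Delta x\to0^+$, $$\|y_{\Delta x,\xi}-y_\xi\|_{L^p(\mathbb R)}\to0\ \ (p=1,2),\qquad \|U_{\Delta x,\xi}-U_\xi\|_{L^2(\mathbb R)}\to0,\qquad \|H_{\Delta x,\xi}-H_\xi\|_{L^p(\mathbb R)}\to0\ \ (p=1,2).$$ -/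

import Mathlib

open MeasureTheory Set Filter Topology
open scoped ContDiff

noncomputable section

namespace HunterSaxton

/-! Function spaces -/

/-- A smooth partition of unity `χ⁺, χ⁻` on the line, with `χ⁺` supported in `(-1, ∞)` and
`χ⁻` supported in `(-∞, 1)`. -/
structure IsCutoffPair (χp χm : ℝ → ℝ) : Prop where
  smooth_p : ContDiff ℝ ∞ χp
  smooth_m : ContDiff ℝ ∞ χm
  add_eq_one : ∀ x, χp x + χm x = 1
  p_mem : ∀ x, χp x ∈ Icc (0 : ℝ) 1
  m_mem : ∀ x, χm x ∈ Icc (0 : ℝ) 1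
  supp_p : tsupport χp ⊆ Ioi (-1)
  supp_m : tsupport χm ⊆ Iio 1

/-- `f` is (the continuous representative of) an element of `H¹(ℝ)`: it is square integrable and
it is a primitive of a square integrable function, its weak derivative. -/
def IsH1 (f : ℝ → ℝ) : Prop :=
  MemLp f 2 volume ∧
    ∃ g : ℝ → ℝ, MemLp g 2 volume ∧ ∀ a b : ℝ, f b - f a = ∫ x in a..b, g x

/-- The space `E₂ = {f + a χ⁺ + b χ⁻ : f ∈ H¹(ℝ), a, b ∈ ℝ}`; it does not depend on the choice
of the partition of unity. -/
def IsE2 (u : ℝ → ℝ) : Prop :=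
  ∃ χp χm : ℝ → ℝ, IsCutoffPair χp χm ∧
    ∃ (f : ℝ → ℝ) (a b : ℝ), IsH1 f ∧ ∀ x, u x = f x + a * χp x + b * χm x

/-- The space `E₁⁰ = {f + a χ⁺ : f ∈ L²(ℝ), a ∈ ℝ}`. -/
def IsE10 (F : ℝ → ℝ) : Prop :=
  ∃ χp χm : ℝ → ℝ, IsCutoffPair χp χm ∧
    ∃ (f : ℝ → ℝ) (a : ℝ), MemLp f 2 volume ∧ ∀ x, F x = f x + a * χp x

/-! Eulerian coordinates -/

/-- The absolutely continuous part of `μ` with respect to Lebesgue measure. -/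
def acPart (μ : Measure ℝ) : Measure ℝ := volume.withDensity (μ.rnDeriv volume)

/-- The singular part of `μ` with respect to Lebesgue measure. -/
def singPart (μ : Measure ℝ) : Measure ℝ := μ.singularPart volume

/-- The left-continuous distribution function `x ↦ μ((-∞, x))`. -/
def cdfLeft (μ : Measure ℝ) (x : ℝ) : ℝ := μ.real (Iio x)

/-- The measure `u_x² dx`. -/
def energy (u : ℝ → ℝ) : Measure ℝ :=
  volume.withDensity fun x => ENNReal.ofReal (deriv u x ^ 2)

/-- A triplet `(u, μ, ν)`. -/
structure EulerData where
  u : ℝ → ℝ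
  μ : Measure ℝ
  ν : Measure ℝ

/-- The set `𝓓` of Eulerian coordinates, for the parameter `α`. -/
structure MemD (α : ℝ) (Z : EulerData) : Prop where
  u_mem : IsE2 Z.u
  finite_μ : IsFiniteMeasure Z.μ
  finite_ν : IsFiniteMeasure Z.ν
  le : Z.μ ≤ Z.ν
  ac_le : acPart Z.μ ≤ acPart Z.ν
  ac_eq : acPart Z.μ = energy Z.u
  cdf_μ : IsE10 (cdfLeft Z.μ)
  cdf_ν : IsE10 (cdfLeft Z.ν)
  of_eq_one : α = 1 → acPart Z.ν = Z.μ ∧ Z.μ = energy Z.u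
  of_lt_one : α < 1 →
    (∀ᵐ x ∂Z.ν, Z.μ.rnDeriv Z.ν x = ENNReal.ofReal (1 - α) ∨ Z.μ.rnDeriv Z.ν x = 1) ∧
    (∀ᵐ x ∂(acPart Z.ν), deriv Z.u x < 0 → (acPart Z.μ).rnDeriv (acPart Z.ν) x = 1)

/-- The set `𝓓₀` of those triplets in `𝓓` with `μ = ν`. -/
def MemD0 (α : ℝ) (Z : EulerData) : Prop := MemD α Z ∧ Z.μ = Z.ν

/-! Lagrangian coordinates -/

/-- A quadruplet `(y, U, V, H)`. -/
structure LagrangeData where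
  y : ℝ → ℝ
  U : ℝ → ℝ
  V : ℝ → ℝ
  H : ℝ → ℝ

/-- The characteristic `y(ξ) = sup {x : ν((-∞, x)) + x < ξ}`. -/
def charY (ν : Measure ℝ) (ξ : ℝ) : ℝ := sSup {x : ℝ | cdfLeft ν x + x < ξ}

/-- `H(ξ) = ξ - y(ξ)`. -/
def charH (ν : Measure ℝ) (ξ : ℝ) : ℝ := ξ - charY ν ξ

/-- The mapping `L` from Eulerian to Lagrangian coordinates. -/
def toLagrange (Z : EulerData) : LagrangeData where
  y := charY Z.ν
  U := fun ξ => Z.u (charY Z.ν ξ)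
  V := fun ξ =>
    ∫ η in Iic ξ, (Z.μ.rnDeriv Z.ν (charY Z.ν η)).toReal * deriv (charH Z.ν) η
  H := charH Z.ν

/-! The projection operator on the grid `x_j = j Δ` -/

/-- The grid point `x_j = j Δ`. -/
def grid (Δ : ℝ) (j : ℤ) : ℝ := j * Δ

/-- The index `j` of the double cell with `x ∈ (x_{2j}, x_{2j+2}]` (for `Δ > 0`). -/
def cellIdx (Δ x : ℝ) : ℤ := ⌈x / (2 * Δ)⌉ - 1

/-- The difference quotient `D f_{2j} = (f(x_{2j+2}) - f(x_{2j})) / (2Δ)`. -/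
def diffQ (Δ : ℝ) (f : ℝ → ℝ) (j : ℤ) : ℝ :=
  (f (grid Δ (2 * j + 2)) - f (grid Δ (2 * j))) / (2 * Δ)

/-- `q_{2j} = √(D F_{ac,2j} - (D u_{2j})²)`. -/
def qCoef (Δ : ℝ) (Z : EulerData) (j : ℤ) : ℝ :=
  √(diffQ Δ (cdfLeft (acPart Z.μ)) j - diffQ Δ Z.u j ^ 2)

/-- The slope of the projected function on `(x_{2j}, x_{2j+1})`; the sign `s j = 1` stands for the
upper and `s j = -1` for the lower sign in `D u_{2j} ∓ q_{2j}`. -/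
def slopeL (Δ : ℝ) (s : ℤ → ℤˣ) (Z : EulerData) (j : ℤ) : ℝ :=
  diffQ Δ Z.u j - ((s j : ℤ) : ℝ) * qCoef Δ Z j

/-- The slope of the projected function on `(x_{2j+1}, x_{2j+2})`, i.e. `D u_{2j} ± q_{2j}`. -/
def slopeR (Δ : ℝ) (s : ℤ → ℤˣ) (Z : EulerData) (j : ℤ) : ℝ :=
  diffQ Δ Z.u j + ((s j : ℤ) : ℝ) * qCoef Δ Z j

/-- The projected function `u_Δ`. -/
def projU (Δ : ℝ) (s : ℤ → ℤˣ) (Z : EulerData) (x : ℝ) : ℝ :=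
  let j := cellIdx Δ x
  if x ≤ grid Δ (2 * j + 1) then
    Z.u (grid Δ (2 * j)) + slopeL Δ s Z j * (x - grid Δ (2 * j))
  else
    Z.u (grid Δ (2 * j + 2)) + slopeR Δ s Z j * (x - grid Δ (2 * j + 2))

/-- The absolutely continuous part `F_{Δ,ac}` of the projected distribution function. -/
def projFac (Δ : ℝ) (s : ℤ → ℤˣ) (Z : EulerData) (x : ℝ) : ℝ :=
  let j := cellIdx Δ x
  let Fac := cdfLeft (acPart Z.μ)
  if x ≤ grid Δ (2 * j + 1) then
    Fac (grid Δ (2 * j)) + slopeL Δ s Z j ^ 2 * (x - grid Δ (2 * j))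
  else
    (Fac (grid Δ (2 * j + 2)) + Fac (grid Δ (2 * j))) / 2
      - 2 * ((s j : ℤ) : ℝ) * qCoef Δ Z j * diffQ Δ Z.u j * Δ
      + slopeR Δ s Z j ^ 2 * (x - grid Δ (2 * j + 1))

/-- The singular part `F_{Δ,sing}` of the projected distribution function. -/
def projFsing (Δ : ℝ) (Z : EulerData) (x : ℝ) : ℝ :=
  cdfLeft (singPart Z.μ) (grid Δ (2 * cellIdx Δ x + 2))

/-- The projected distribution function `F_Δ = F_{Δ,ac} + F_{Δ,sing}`. -/
def projF (Δ : ℝ) (s : ℤ → ℤˣ) (Z : EulerData) (x : ℝ) : ℝ :=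
  projFac Δ s Z x + projFsing Δ Z x

open Classical in
/-- The (unique) finite measure `m` with `m((-∞, x)) = F(x)` for all `x`; by convention `0` if
there is no such measure. -/
def measureOfCdf (F : ℝ → ℝ) : Measure ℝ :=
  if h : ∃ m : Measure ℝ, IsFiniteMeasure m ∧ ∀ x, cdfLeft m x = F x then h.choose else 0

/-- The projection operator `P_Δ` on `𝓓₀`, for the choice `s` of signs. The measures exist, see
`cdfLeft_measureOfCdf_projF`. -/
def project (Δ : ℝ) (s : ℤ → ℤˣ) (Z : EulerData) : EulerData where
  u := projU Δ s Z
  μ := measureOfCdf (projF Δ s Z)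
  ν := measureOfCdf (projF Δ s Z)

/-! The measures in the projection operator exist -/

lemma IsE2.exists_primitive {u : ℝ → ℝ} (hu : IsE2 u) :
    ∃ h : ℝ → ℝ, LocallyIntegrable h volume ∧ ∀ a b : ℝ, u b - u a = ∫ x in a..b, h x := by
  obtain ⟨χp, χm, hχ, f, A, B, ⟨-, g, hg, hfg⟩, hu⟩ := hu
  have hp : ∀ x, HasDerivAt χp (deriv χp x) x := fun x =>
    (hχ.smooth_p.differentiable (by simp) x).hasDerivAt
  have hm : ∀ x, HasDerivAt χm (deriv χm x) x := fun x =>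
    (hχ.smooth_m.differentiable (by simp) x).hasDerivAt
  have cp : Continuous (deriv χp) := hχ.smooth_p.continuous_deriv (by simp)
  have cm : Continuous (deriv χm) := hχ.smooth_m.continuous_deriv (by simp)
  have hgl : LocallyIntegrable g volume := hg.locallyIntegrable (by norm_num)
  refine ⟨fun x => g x + (A * deriv χp x + B * deriv χm x), ?_, ?_⟩
  · exact hgl.add (Continuous.locallyIntegrable (by fun_prop))
  · intro a b
    have hc : Continuous fun x => A * deriv χp x + B * deriv χm x := by fun_prop
    rw [intervalIntegral.integral_add
        (hgl.integrableOn_isCompact isCompact_uIcc |>.intervalIntegrable)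
        (hc.intervalIntegrable a b), ← hfg]
    rw [intervalIntegral.integral_eq_sub_of_hasDerivAt
        (f := fun x => A * χp x + B * χm x)
        (fun x _ => ((hp x).const_mul A).add ((hm x).const_mul B)) (hc.intervalIntegrable a b)]
    rw [hu, hu]; ring

lemma IsE2.sub_eq_integral_deriv {u : ℝ → ℝ} (hu : IsE2 u) (a b : ℝ) :
    u b - u a = ∫ x in a..b, deriv u x := by
  obtain ⟨h, hl, hh⟩ := hu.exists_primitive
  rw [hh]
  have key : ∀ᵐ x ∂volume, deriv u x = h x := by
    filter_upwards [LocallyIntegrable.ae_hasDerivAt_integral hl] with x hx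
    have h1 : HasDerivAt (fun y => u 0 + ∫ t in (0 : ℝ)..y, h t) (h x) x := (hx 0).const_add _
    have h2 : (fun y => u 0 + ∫ t in (0 : ℝ)..y, h t) = u := by
      funext y; rw [← hh]; ring
    rw [h2] at h1
    exact h1.deriv
  refine (intervalIntegral.integral_congr_ae ?_).symm
  filter_upwards [key] with x hx _ using hx

lemma acPart_le (μ : Measure ℝ) : acPart μ ≤ μ := Measure.withDensity_rnDeriv_le _ _

lemma cdfLeft_sub (m : Measure ℝ) [IsFiniteMeasure m] {a b : ℝ} (hab : a ≤ b) :
    cdfLeft m b - cdfLeft m a = m.real (Ico a b) := by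
  have : Iio b = Iio a ∪ Ico a b := by
    rw [Iio_union_Ico_eq_Iio hab]
  rw [cdfLeft, cdfLeft, this, measureReal_union _ measurableSet_Ico]
  · ring
  · rw [disjoint_left]; intro x hx hx'; exact absurd hx'.1 (not_le.2 hx)

lemma sq_sub_le {α : ℝ} {Z : EulerData} (hZ : MemD α Z) {a b : ℝ} (hab : a < b) :
    (Z.u b - Z.u a) ^ 2 ≤
      (b - a) * (cdfLeft (acPart Z.μ) b - cdfLeft (acPart Z.μ) a) := by
  have := hZ.finite_μ
  have : IsFiniteMeasure (acPart Z.μ) := isFiniteMeasure_of_le _ (acPart_le _)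
  have hfin : (acPart Z.μ) (Ico a b) ≠ ⊤ := measure_ne_top _ _
  rw [cdfLeft_sub _ hab.le, measureReal_def]
  rw [hZ.ac_eq, energy, withDensity_apply _ measurableSet_Ico] at hfin ⊢
  have hmeas : Measurable (deriv Z.u) := measurable_deriv _
  have hsq : IntegrableOn (fun x => deriv Z.u x ^ 2) (Ico a b) := by
    refine ⟨(hmeas.pow_const 2).aestronglyMeasurable, ?_⟩
    rw [hasFiniteIntegral_iff_ofReal (Eventually.of_forall fun x => sq_nonneg _)]
    exact lt_top_iff_ne_top.2 hfin
  have hL2 : MemLp (deriv Z.u) 2 (volume.restrict (Ico a b)) :=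
    (memLp_two_iff_integrable_sq hmeas.aestronglyMeasurable).2 hsq
  have hL1 : IntegrableOn (deriv Z.u) (Ico a b) := hL2.integrable (by norm_num)
  rw [hZ.u_mem.sub_eq_integral_deriv a b, intervalIntegral.integral_of_le hab.le,
    ← integral_Ico_eq_integral_Ioc,
    ← integral_eq_lintegral_of_nonneg_ae (Eventually.of_forall fun x => sq_nonneg _)
      (hmeas.pow_const 2).aestronglyMeasurable]
  set I := ∫ x in Ico a b, deriv Z.u x
  set c := I / (b - a)
  have h0 : 0 ≤ ∫ x in Ico a b, (deriv Z.u x - c) ^ 2 := integral_nonneg fun x => sq_nonneg _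
  have h1 : ∫ x in Ico a b, (deriv Z.u x - c) ^ 2
      = (∫ x in Ico a b, deriv Z.u x ^ 2) - 2 * c * I + c ^ 2 * (b - a) := by
    have e : (fun x => (deriv Z.u x - c) ^ 2)
        = fun x => (deriv Z.u x ^ 2 - 2 * c * deriv Z.u x) + c ^ 2 := by funext x; ring
    have i2 : IntegrableOn (fun x => 2 * c * deriv Z.u x) (Ico a b) := hL1.const_mul _
    have i1 : IntegrableOn (fun x => deriv Z.u x ^ 2 - 2 * c * deriv Z.u x) (Ico a b) :=
      hsq.sub i2
    have i3 : IntegrableOn (fun _ : ℝ => c ^ 2) (Ico a b) := by simp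
    rw [e, integral_add i1 i3, integral_sub hsq i2, integral_const_mul]
    simp [hab.le, measureReal_def]; ring
  have hb : 0 < b - a := sub_pos.2 hab
  have hc : c * (b - a) = I := by simp only [c]; field_simp
  rw [h1] at h0
  nlinarith [mul_nonneg hb.le h0]

lemma qCoef_sq {α : ℝ} {Z : EulerData} (hZ : MemD α Z) {Δ : ℝ} (hΔ : 0 < Δ) (j : ℤ) :
    qCoef Δ Z j ^ 2 = diffQ Δ (cdfLeft (acPart Z.μ)) j - diffQ Δ Z.u j ^ 2 := by
  rw [qCoef, Real.sq_sqrt]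
  have hab : grid Δ (2 * j) < grid Δ (2 * j + 2) := by
    simp only [grid]; push_cast; nlinarith
  have h := sq_sub_le hZ hab
  have e : grid Δ (2 * j + 2) - grid Δ (2 * j) = 2 * Δ := by
    simp only [grid]; push_cast; ring
  rw [e] at h
  simp only [diffQ]
  have h2 : 0 < 2 * Δ := by linarith
  rw [sub_nonneg, div_pow, div_le_div_iff₀ (by positivity) h2]
  nlinarith

/-- The slope of the projected function, on half-open cells. -/
def slopeFun (Δ : ℝ) (s : ℤ → ℤˣ) (Z : EulerData) (x : ℝ) : ℝ :=
  if x < grid Δ (2 * ⌊x / (2 * Δ)⌋ + 1) then slopeL Δ s Z ⌊x / (2 * Δ)⌋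
  else slopeR Δ s Z ⌊x / (2 * Δ)⌋

lemma floor_eq_of_mem {Δ : ℝ} (hΔ : 0 < Δ) {j : ℤ} {x : ℝ} (h1 : grid Δ (2 * j) ≤ x)
    (h2 : x < grid Δ (2 * j + 2)) : ⌊x / (2 * Δ)⌋ = j := by
  have h3 : 0 < 2 * Δ := by linarith
  simp only [grid] at h1 h2
  push_cast at h1 h2
  rw [Int.floor_eq_iff, le_div_iff₀ h3, div_lt_iff₀ h3]
  constructor <;> linarith

lemma mem_of_floor_eq {Δ : ℝ} (hΔ : 0 < Δ) {j : ℤ} {x : ℝ} (h : ⌊x / (2 * Δ)⌋ = j) :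
    grid Δ (2 * j) ≤ x ∧ x < grid Δ (2 * j + 2) := by
  have h3 : 0 < 2 * Δ := by linarith
  rw [Int.floor_eq_iff, le_div_iff₀ h3, div_lt_iff₀ h3] at h
  simp only [grid]
  push_cast
  constructor <;> linarith [h.1, h.2]

lemma withDensity_Ico_of_const {σ : ℝ → ℝ} {a b c : ℝ} (h : ∀ x ∈ Ico a b, σ x = c) :
    (volume.withDensity fun x => ENNReal.ofReal (σ x ^ 2)) (Ico a b)
      = ENNReal.ofReal (c ^ 2 * (b - a)) := by
  rw [withDensity_apply _ measurableSet_Ico,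
    setLIntegral_congr_fun (g := fun _ => ENNReal.ofReal (c ^ 2)) measurableSet_Ico
      (fun x hx => by simp only [h x hx])]
  rw [setLIntegral_const, Real.volume_Ico, ENNReal.ofReal_mul (sq_nonneg _)]

lemma exists_measure_projF {α : ℝ} {Z : EulerData} (hZ : MemD α Z) {Δ : ℝ} (hΔ : 0 < Δ)
    (s : ℤ → ℤˣ) :
    ∃ m : Measure ℝ, IsFiniteMeasure m ∧ ∀ x, cdfLeft m x = projF Δ s Z x := by
  have := hZ.finite_μ
  have hacfin : IsFiniteMeasure (acPart Z.μ) := isFiniteMeasure_of_le _ (acPart_le _)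
  have hsfin : IsFiniteMeasure (singPart Z.μ) :=
    isFiniteMeasure_of_le _ (Measure.singularPart_le _ _)
  have h2Δ : 0 < 2 * Δ := by linarith
  set fl : ℝ → ℤ := fun x => ⌊x / (2 * Δ)⌋ with hfl
  have mfl : Measurable fl := Int.measurable_floor.comp (measurable_id.div_const _)
  set m1 : Measure ℝ := volume.withDensity fun x => ENNReal.ofReal (slopeFun Δ s Z x ^ 2)
    with hm1
  set T : ℝ → ℝ := fun x => grid Δ (2 * fl x) with hT
  have mT : Measurable T := (measurable_from_top (f := fun j : ℤ => grid Δ (2 * j))).comp mfl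
  set m2 : Measure ℝ := (singPart Z.μ).map T with hm2
  have e1 : ∀ j : ℤ, grid Δ (2 * j + 1) = grid Δ (2 * j) + Δ := fun j => by
    simp only [grid]; push_cast; ring
  have e2 : ∀ j : ℤ, grid Δ (2 * j + 2) = grid Δ (2 * j) + 2 * Δ := fun j => by
    simp only [grid]; push_cast; ring
  have hsgn : ∀ j : ℤ, (((s j : ℤ) : ℝ)) ^ 2 = 1 := fun j => by
    rcases Int.units_eq_one_or (s j) with h | h <;> simp [h]
  have hL : ∀ (j : ℤ) (y : ℝ), y ≤ grid Δ (2 * j + 1) →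
      m1 (Ico (grid Δ (2 * j)) y)
        = ENNReal.ofReal (slopeL Δ s Z j ^ 2 * (y - grid Δ (2 * j))) := by
    intro j y hy
    refine withDensity_Ico_of_const fun x hx => ?_
    have := floor_eq_of_mem hΔ hx.1 (by have := e1 j; have := e2 j; linarith [hx.2])
    rw [slopeFun, this, if_pos (lt_of_lt_of_le hx.2 hy)]
  have hR : ∀ (j : ℤ) (y : ℝ), y ≤ grid Δ (2 * j + 2) →
      m1 (Ico (grid Δ (2 * j + 1)) y)
        = ENNReal.ofReal (slopeR Δ s Z j ^ 2 * (y - grid Δ (2 * j + 1))) := by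
    intro j y hy
    refine withDensity_Ico_of_const fun x hx => ?_
    have := floor_eq_of_mem hΔ (by have := e1 j; linarith [hx.1]) (lt_of_lt_of_le hx.2 hy)
    rw [slopeFun, this, if_neg (not_lt.2 hx.1)]
  have hLR : ∀ (j : ℤ) (y : ℝ), grid Δ (2 * j + 1) ≤ y → y ≤ grid Δ (2 * j + 2) →
      m1 (Ico (grid Δ (2 * j)) y)
        = ENNReal.ofReal (slopeL Δ s Z j ^ 2 * Δ
            + slopeR Δ s Z j ^ 2 * (y - grid Δ (2 * j + 1))) := by
    intro j y hy1 hy2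
    have hu : Ico (grid Δ (2 * j)) y
        = Ico (grid Δ (2 * j)) (grid Δ (2 * j + 1)) ∪ Ico (grid Δ (2 * j + 1)) y :=
      (Ico_union_Ico_eq_Ico (by rw [e1]; linarith) hy1).symm
    rw [hu, measure_union _ measurableSet_Ico, hL j _ le_rfl, hR j y hy2,
      ENNReal.ofReal_add (by positivity) (mul_nonneg (sq_nonneg _) (by linarith)), e1]
    · simp
    · rw [disjoint_left]; intro x hx hx'; exact absurd hx'.1 (not_le.2 hx.2)
  have hpre : ∀ j : ℤ, fl ⁻¹' {j} = Ico (grid Δ (2 * j)) (grid Δ (2 * j + 2)) := by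
    intro j; ext x
    exact ⟨fun h => mem_of_floor_eq hΔ h, fun h => floor_eq_of_mem hΔ h.1 h.2⟩
  have hq := qCoef_sq hZ hΔ
  have hD : ∀ j : ℤ, diffQ Δ (cdfLeft (acPart Z.μ)) j * (2 * Δ)
      = cdfLeft (acPart Z.μ) (grid Δ (2 * j + 2)) - cdfLeft (acPart Z.μ) (grid Δ (2 * j)) :=
    fun j => by rw [diffQ]; field_simp
  have hmap : m1.map fl = (acPart Z.μ).map fl := by
    refine Measure.ext_of_singleton fun j => ?_
    rw [Measure.map_apply mfl (measurableSet_singleton _),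
      Measure.map_apply mfl (measurableSet_singleton _), hpre,
      hLR j _ (by rw [e1, e2]; linarith) le_rfl]
    rw [← ENNReal.ofReal_toReal (measure_ne_top (acPart Z.μ) _), ← measureReal_def,
      ← cdfLeft_sub _ (by rw [e2]; linarith), ← hD, e1, e2]
    congr 1
    simp only [slopeL, slopeR]
    linear_combination (2 * Δ * ((s j : ℤ) : ℝ) ^ 2) * hq j
      + 2 * Δ * (diffQ Δ (cdfLeft (acPart Z.μ)) j - diffQ Δ Z.u j ^ 2) * hsgn j
  have hm1fin : IsFiniteMeasure m1 := by
    refine ⟨?_⟩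
    have h := congrArg (fun m : Measure ℤ => m univ) hmap
    simp only [Measure.map_apply mfl MeasurableSet.univ, preimage_univ] at h
    rw [h]; exact measure_lt_top _ _
  have hIio : ∀ j : ℤ, cdfLeft m1 (grid Δ (2 * j)) = cdfLeft (acPart Z.μ) (grid Δ (2 * j)) := by
    intro j
    have hset : fl ⁻¹' (Iio j) = Iio (grid Δ (2 * j)) := by
      ext x
      simp only [mem_preimage, mem_Iio, hfl, Int.floor_lt, div_lt_iff₀ h2Δ, grid]
      push_cast
      constructor <;> intro h <;> linarith
    have h := congrArg (fun m : Measure ℤ => m (Iio j)) hmap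
    simp only [Measure.map_apply mfl (measurableSet_Iio), hset] at h
    rw [cdfLeft, cdfLeft, measureReal_def, measureReal_def, h]
  refine ⟨m1 + m2, inferInstance, fun x => ?_⟩
  set j := cellIdx Δ x with hj
  have hj' : x / (2 * Δ) ≤ ((j + 1 : ℤ) : ℝ) ∧ ((j : ℤ) : ℝ) < x / (2 * Δ) := by
    constructor
    · rw [hj, cellIdx, sub_add_cancel]; exact Int.le_ceil _
    · rw [← Int.lt_ceil, hj, cellIdx]; omega
  rw [div_le_iff₀ h2Δ, lt_div_iff₀ h2Δ] at hj'
  have hx1 : grid Δ (2 * j) < x := by simp only [grid]; push_cast; linarith [hj'.2]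
  have hx2 : x ≤ grid Δ (2 * j + 2) := by
    have := hj'.1; simp only [grid]; push_cast at this ⊢; linarith
  have hadd : cdfLeft (m1 + m2) x = cdfLeft m1 x + cdfLeft m2 x := by
    simp only [cdfLeft]; rw [measureReal_add_apply]
  have hsing : cdfLeft m2 x = projFsing Δ Z x := by
    rw [projFsing, cdfLeft, cdfLeft, measureReal_def, measureReal_def, hm2,
      Measure.map_apply mT measurableSet_Iio]
    congr 2
    ext z
    have hz := mem_of_floor_eq hΔ (rfl : ⌊z / (2 * Δ)⌋ = fl z)
    simp only [mem_preimage, mem_Iio, hT]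
    constructor
    · intro h
      have : fl z ≤ j := by
        by_contra hcon
        have hcon : (j : ℝ) + 1 ≤ fl z := by exact_mod_cast not_le.1 hcon
        have : grid Δ (2 * j + 2) ≤ grid Δ (2 * fl z) := by
          simp only [grid]; push_cast; nlinarith
        linarith
      have this : (fl z : ℝ) ≤ j := by exact_mod_cast this
      refine lt_of_lt_of_le hz.2 ?_
      change grid Δ (2 * fl z + 2) ≤ grid Δ (2 * j + 2)
      simp only [grid]; push_cast; nlinarith
    · intro h
      have : fl z < j + 1 := by
        by_contra hcon
        have hcon : (j : ℝ) + 1 ≤ fl z := by exact_mod_cast not_lt.1 hcon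
        have : grid Δ (2 * j + 2) ≤ grid Δ (2 * fl z) := by
          simp only [grid]; push_cast; nlinarith
        linarith [hz.1]
      have this : (fl z : ℝ) ≤ j := by exact_mod_cast Int.lt_add_one_iff.1 this
      refine lt_of_le_of_lt ?_ hx1
      simp only [grid]; push_cast; nlinarith
  have hac : cdfLeft m1 x = projFac Δ s Z x := by
    have h1 := cdfLeft_sub m1 hx1.le
    rw [hIio, measureReal_def] at h1
    simp only [projFac, ← hj]
    split_ifs with hc
    · rw [hL j x hc, ENNReal.toReal_ofReal
        (mul_nonneg (sq_nonneg _) (by linarith))] at h1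
      linarith
    · have hc := (not_le.1 hc).le
      rw [hLR j x hc hx2, ENNReal.toReal_ofReal (add_nonneg (by positivity)
        (mul_nonneg (sq_nonneg _) (by linarith)))] at h1
      have hq2 : slopeL Δ s Z j ^ 2 * Δ
          = (cdfLeft (acPart Z.μ) (grid Δ (2 * j + 2))
              - cdfLeft (acPart Z.μ) (grid Δ (2 * j))) / 2
            - 2 * ((s j : ℤ) : ℝ) * qCoef Δ Z j * diffQ Δ Z.u j * Δ := by
        rw [← hD]
        simp only [slopeL]
        linear_combination (Δ * ((s j : ℤ) : ℝ) ^ 2) * hq j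
          + Δ * (diffQ Δ (cdfLeft (acPart Z.μ)) j - diffQ Δ Z.u j ^ 2) * hsgn j
      linarith
  rw [hadd, hac, hsing, projF]

/-- On `𝓓₀` the measures of the projected data have the prescribed distribution function. -/
theorem cdfLeft_measureOfCdf_projF {α : ℝ} {Z : EulerData} (hZ : MemD0 α Z) {Δ : ℝ}
    (hΔ : 0 < Δ) (s : ℤ → ℤˣ) :
    IsFiniteMeasure (measureOfCdf (projF Δ s Z)) ∧
      ∀ x, cdfLeft (measureOfCdf (projF Δ s Z)) x = projF Δ s Z x := by
  have h := exists_measure_projF hZ.1 hΔ s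
  rw [measureOfCdf, dif_pos h]
  exact h.choose_spec

/-! Regularity and convergence of the derivatives in Lagrangian coordinates -/

/-- `y`, `U`, `H` are Lipschitz continuous, so that their almost everywhere derivatives are their
weak derivatives, and `U_ξ ∈ L²(ℝ)`, `H_ξ ∈ L¹(ℝ) ∩ L²(ℝ)`. -/
structure HasRegularDerivs (X : LagrangeData) : Prop where
  lipschitz_y : ∃ K, LipschitzWith K X.y
  lipschitz_U : ∃ K, LipschitzWith K X.U
  lipschitz_H : ∃ K, LipschitzWith K X.H
  memLp_U : MemLp (deriv X.U) 2 volume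
  memLp_H_one : MemLp (deriv X.H) 1 volume
  memLp_H_two : MemLp (deriv X.H) 2 volume

/-- `‖f_Δ' - f'‖_p → 0` as `Δ → 0` with `Δ > 0`. -/
def DerivTendsto (p : ENNReal) (fΔ : ℝ → ℝ → ℝ) (f : ℝ → ℝ) : Prop :=
  Tendsto (fun Δ => eLpNorm (fun ξ => deriv (fΔ Δ) ξ - deriv f ξ) p volume) (𝓝[>] 0) (𝓝 0)

end HunterSaxton

end

/-!
Write `λ = dx + m` for the energy measure `m = w² dx + σ` of a function `u` with weak derivative
`w`, where `σ` is carried by a null set `N`. The characteristic `y` pushes Lebesgue measure forward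
to `λ` (`map_charY_volume`), and `dx` has density `k = 1 / (1 + w²)` off `N`, `k = 0` on `N`, with respect
to `λ`. Changing variables along `y` (`IsEnergyDatum.integral_comp_charY`) gives, almost everywhere,
`y_ξ = k ∘ y`, `H_ξ = (1 - k) ∘ y` and `U_ξ = (w k) ∘ y`. All three functions are therefore
1-Lipschitz, and since `w² k² = k (1 - k)`,

`∫ H_ξ = m(ℝ)`,  `∫ U_ξ² = ∫ y_ξ H_ξ = E(w)`,  `∫ H_ξ² = m(ℝ) - E(w)`,  `E(w) = ∫ w² / (1 + w²) dx`.

Both the given triplet and its projections are of this form; the singular part of a projected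
measure sits on the even grid points (`measureOfCdf_projF`). The projection keeps `m(ℝ)` and
`∫ w²`, and by Lebesgue differentiation its slopes converge almost everywhere to `u_x`
(`tendsto_slopeFun_ae`), so Scheffé's argument gives convergence of `E` (`tendsto_regEnergy`). Hence
the `L²` norms of `U_ξ` and `H_ξ` converge. On the other hand the distribution functions agree at
the even grid points, so `y` and `U` converge pointwise (`tendsto_charY`, `tendsto_projU_charY`),
which makes the derivatives converge weakly. Weak convergence and convergence of the norms yield
strong `L²` convergence (`tendsto_integral_sq_deriv_sub`). Finally `H_ξ ≥ 0` has the same mass for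
all data, which upgrades `L²` to `L¹` convergence (`tendsto_eLpNorm_one_of_integral_sq`), and
`y_ξ = 1 - H_ξ`.
-/

namespace HunterSaxton

/-! ### The characteristic as a generalized inverse -/

section Characteristic

lemma cdfLeft_nonneg (m : Measure ℝ) (x : ℝ) : 0 ≤ cdfLeft m x := measureReal_nonneg

lemma cdfLeft_le (m : Measure ℝ) [IsFiniteMeasure m] (x : ℝ) : cdfLeft m x ≤ m.real univ :=
  measureReal_mono (subset_univ _)

lemma cdfLeft_mono (m : Measure ℝ) [IsFiniteMeasure m] : Monotone (cdfLeft m) :=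
  fun _ _ h => measureReal_mono (Iio_subset_Iio h)

lemma bddAbove_charY_set (m : Measure ℝ) (ξ : ℝ) : BddAbove {x : ℝ | cdfLeft m x + x < ξ} :=
  ⟨ξ, fun x (hx : _ < ξ) => by linarith [cdfLeft_nonneg m x]⟩

lemma le_charY {m : Measure ℝ} {ξ x : ℝ} (h : cdfLeft m x + x < ξ) : x ≤ charY m ξ :=
  le_csSup (bddAbove_charY_set m ξ) h

lemma nonempty_charY_set (m : Measure ℝ) [IsFiniteMeasure m] (ξ : ℝ) :
    {x : ℝ | cdfLeft m x + x < ξ}.Nonempty :=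
  ⟨ξ - m.real univ - 1, by
    change _ < ξ
    linarith [cdfLeft_le m (ξ - m.real univ - 1)]⟩

variable {m : Measure ℝ} [IsFiniteMeasure m]

lemma charY_le {ξ x : ℝ} (h : ξ ≤ cdfLeft m x + x) : charY m ξ ≤ x := by
  refine csSup_le (nonempty_charY_set m ξ) fun z (hz : _ < ξ) => ?_
  by_contra hc
  have := cdfLeft_mono m (not_le.1 hc).le
  linarith

lemma charY_mono (m : Measure ℝ) [IsFiniteMeasure m] : Monotone (charY m) := fun _ b h =>
  csSup_le_csSup (bddAbove_charY_set m b) (nonempty_charY_set m _) fun _ hx => lt_of_lt_of_le hx h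

/-- Left continuity of the distribution function, in the form in which it is used. -/
lemma cdfLeft_le_of_forall_lt (m : Measure ℝ) [IsFiniteMeasure m] {x c : ℝ}
    (hc : ∀ z < x, cdfLeft m z ≤ c) : cdfLeft m x ≤ c := by
  have hU : Iio x = ⋃ n : ℕ, Iio (x - 1 / ((n : ℝ) + 1)) := by
    ext z
    simp only [mem_Iio, mem_iUnion]
    constructor
    · intro h
      obtain ⟨n, hn⟩ := exists_nat_one_div_lt (sub_pos.2 h)
      exact ⟨n, by linarith⟩
    · rintro ⟨n, hn⟩
      have : 0 < 1 / ((n : ℝ) + 1) := by positivity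
      linarith
  have hmono : Monotone fun n : ℕ => Iio (x - 1 / ((n : ℝ) + 1)) := by
    intro n k hnk
    refine Iio_subset_Iio ?_
    have := Nat.one_div_le_one_div (α := ℝ) hnk
    linarith
  have ht := tendsto_measure_iUnion_atTop (μ := m) hmono
  rw [← hU] at ht
  have ht' := (ENNReal.tendsto_toReal (measure_ne_top m _)).comp ht
  refine le_of_tendsto ht' (Eventually.of_forall fun n => hc _ ?_)
  have : 0 < 1 / ((n : ℝ) + 1) := by positivity
  linarith

lemma le_of_le_charY {ξ x : ℝ} (h : x ≤ charY m ξ) : cdfLeft m x + x ≤ ξ := by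
  have key : ∀ z < x, cdfLeft m z ≤ ξ - z := fun z hz => by
    by_contra hc
    exact absurd (charY_le (m := m) (ξ := ξ) (x := z) (by linarith [not_le.1 hc])) (by linarith)
  have : ∀ ε > 0, cdfLeft m x ≤ ξ - x + ε := fun ε hε => by
    refine cdfLeft_le_of_forall_lt m fun z hz => ?_
    have h1 := cdfLeft_mono m (le_max_left z (x - ε))
    have h2 := key (max z (x - ε)) (max_lt hz (by linarith))
    have h3 := le_max_right z (x - ε)
    linarith
  have := le_of_forall_pos_le_add this
  linarith

/-- The characteristic pushes Lebesgue measure forward to `dx + m`. -/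
lemma map_charY_volume (m : Measure ℝ) [IsFiniteMeasure m] :
    (volume : Measure ℝ).map (charY m) = volume + m := by
  symm
  refine Measure.ext_of_Ico' _ _
    (fun a b _ => by simp [Measure.add_apply, measure_ne_top m]) fun a b hab => ?_
  rw [Measure.map_apply (charY_mono m).measurable measurableSet_Ico]
  have hset : charY m ⁻¹' Ico a b =ᵐ[volume] Ico (cdfLeft m a + a) (cdfLeft m b + b) := by
    have h0 : ∀ c : ℝ, ∀ᵐ ξ ∂(volume : Measure ℝ), ξ ≠ c := fun c => by
      simp [ae_iff, measure_singleton]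
    filter_upwards [h0 (cdfLeft m a + a), h0 (cdfLeft m b + b)] with ξ h1 h2
    refine propext ?_
    change (a ≤ charY m ξ ∧ charY m ξ < b) ↔ (_ ≤ ξ ∧ ξ < _)
    constructor
    · rintro ⟨h3, h4⟩
      refine ⟨le_of_le_charY h3, ?_⟩
      by_contra hc
      exact absurd (le_charY (lt_of_le_of_ne (not_lt.1 hc) h2.symm)) (not_le.2 h4)
    · rintro ⟨h3, h4⟩
      refine ⟨le_charY (lt_of_le_of_ne h3 h1.symm), ?_⟩
      by_contra hc
      exact absurd (le_of_le_charY (not_lt.1 hc)) (not_le.2 h4)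
  rw [measure_congr hset, Real.volume_Ico, Measure.add_apply, Real.volume_Ico,
    ← ENNReal.ofReal_toReal (measure_ne_top m _), ← measureReal_def, ← cdfLeft_sub m hab.le,
    ← ENNReal.ofReal_add (by linarith) (by linarith [cdfLeft_mono m hab.le])]
  congr 1; ring

lemma charH_mono (m : Measure ℝ) [IsFiniteMeasure m] : Monotone (charH m) := by
  intro ξ η h
  simp only [charH]
  by_contra hc
  obtain ⟨r, h1, h2⟩ : ∃ r, charY m ξ + (η - ξ) < r ∧ r < charY m η := exists_between (by linarith)
  obtain ⟨t, h3, h4⟩ := exists_between h2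
  -- `t ≤ y η` bounds `F t + t` from above, while `r - (η - ξ) > y ξ` bounds it from below
  have h5 := le_of_le_charY h4.le
  have h6 : ¬ cdfLeft m (r - (η - ξ)) + (r - (η - ξ)) < ξ := fun h => by linarith [le_charY h]
  have h7 := cdfLeft_mono m (show r - (η - ξ) ≤ t by linarith)
  linarith

lemma lipschitzWith_charY (m : Measure ℝ) [IsFiniteMeasure m] : LipschitzWith 1 (charY m) := by
  refine LipschitzWith.of_le_add fun ξ η => ?_
  rw [Real.dist_eq]
  rcases le_total ξ η with h | h
  · linarith [charY_mono m h, abs_nonneg (ξ - η)]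
  · have := charH_mono m h
    simp only [charH] at this
    linarith [le_abs_self (ξ - η)]

lemma lipschitzWith_charH (m : Measure ℝ) [IsFiniteMeasure m] : LipschitzWith 1 (charH m) := by
  refine LipschitzWith.of_le_add fun ξ η => ?_
  rw [Real.dist_eq]
  rcases le_total ξ η with h | h
  · linarith [charH_mono m h, abs_nonneg (ξ - η)]
  · have := charY_mono m h
    simp only [charH]
    linarith [le_abs_self (ξ - η)]

end Characteristic

/-! ### Functions with an energy measure -/

/-- `u` is a primitive of `w`, and the finite measure `m` is `w² dx + σ`, where the singular part
`σ` is carried by the Lebesgue null set `N`. -/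
structure IsEnergyDatum (u w : ℝ → ℝ) (m σ : Measure ℝ) (N : Set ℝ) : Prop where
  finite : IsFiniteMeasure m
  measurable_w : Measurable w
  measurableSet_N : MeasurableSet N
  volume_N : volume N = 0
  sing_compl : σ Nᶜ = 0
  eq_add : m = (volume.withDensity fun x => ENNReal.ofReal (w x ^ 2)) + σ
  sub_eq : ∀ a b, u b - u a = ∫ x in a..b, w x

/-- The density of Lebesgue measure with respect to `dx + m`: it is `1 / (1 + w²)` off the null set
`N` that carries the singular part of `m`, and `0` on `N`. -/
noncomputable def lebDensity (w : ℝ → ℝ) (N : Set ℝ) : ℝ → ℝ :=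
  Nᶜ.indicator fun x => 1 / (1 + w x ^ 2)

lemma lebDensity_nonneg (w : ℝ → ℝ) (N : Set ℝ) (x : ℝ) : 0 ≤ lebDensity w N x :=
  indicator_nonneg (fun _ _ => by positivity) x

lemma lebDensity_le_one (w : ℝ → ℝ) (N : Set ℝ) (x : ℝ) : lebDensity w N x ≤ 1 := by
  refine indicator_apply_le' (fun _ => ?_) fun _ => zero_le_one
  rw [div_le_one (by positivity)]
  linarith [sq_nonneg (w x)]

lemma abs_mul_lebDensity_le (w : ℝ → ℝ) (N : Set ℝ) (x : ℝ) : |w x * lebDensity w N x| ≤ 1 := by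
  by_cases h : x ∈ Nᶜ
  · rw [lebDensity, indicator_of_mem h, mul_one_div, abs_div,
      abs_of_pos (by positivity : 0 < 1 + w x ^ 2), div_le_one (by positivity), ← sq_abs]
    nlinarith [sq_nonneg (|w x| - 1), abs_nonneg (w x)]
  · rw [lebDensity, indicator_of_notMem h]; simp

/-- The relation `U_ξ² = y_ξ H_ξ` on the level of densities. -/
lemma sq_mul_lebDensity_sq (w : ℝ → ℝ) (N : Set ℝ) (x : ℝ) :
    w x ^ 2 * lebDensity w N x ^ 2 = (1 - lebDensity w N x) * lebDensity w N x := by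
  by_cases h : x ∈ Nᶜ
  · rw [lebDensity, indicator_of_mem h]; field_simp; ring
  · rw [lebDensity, indicator_of_notMem h]; simp

/-- The regularized energy `∫ w² / (1 + w²) dx`. -/
noncomputable def regEnergy (w : ℝ → ℝ) : ℝ := ∫ x, w x ^ 2 / (1 + w x ^ 2)

section Primitive

lemma deriv_ae_eq_of_sub_eq {P f : ℝ → ℝ} (hf : LocallyIntegrable f volume)
    (h : ∀ a b, P b - P a = ∫ x in a..b, f x) : deriv P =ᵐ[volume] f := by
  filter_upwards [LocallyIntegrable.ae_hasDerivAt_integral hf] with x hx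
  have h2 : (fun y => P 0 + ∫ t in (0 : ℝ)..y, f t) = P := by
    funext y; rw [← h]; ring
  have h1 : HasDerivAt (fun y => P 0 + ∫ t in (0 : ℝ)..y, f t) (f x) x := (hx 0).const_add _
  rw [h2] at h1
  exact h1.deriv

lemma lipschitzWith_one_of_sub_eq {P f : ℝ → ℝ} (hf : ∀ x, |f x| ≤ 1)
    (h : ∀ a b, P b - P a = ∫ x in a..b, f x) : LipschitzWith 1 P := by
  refine LipschitzWith.of_dist_le_mul fun x y => ?_
  rw [Real.dist_eq, Real.dist_eq, h y x]
  exact intervalIntegral.norm_integral_le_of_norm_le_const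
    fun z _ => (Real.norm_eq_abs _).trans_le (hf z)

lemma locallyIntegrable_of_abs_le_one {f : ℝ → ℝ} (hm : Measurable f) (hf : ∀ x, |f x| ≤ 1) :
    LocallyIntegrable f volume :=
  (locallyIntegrable_const (1 : ℝ)).mono hm.aestronglyMeasurable
    (Eventually.of_forall fun x => by simpa using hf x)

end Primitive

namespace IsEnergyDatum

variable {u w : ℝ → ℝ} {m σ : Measure ℝ} {N : Set ℝ}

lemma integrable_sq (h : IsEnergyDatum u w m σ N) : Integrable (fun x => w x ^ 2) volume := by
  have := h.finite
  refine ⟨(h.measurable_w.pow_const 2).aestronglyMeasurable, ?_⟩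
  rw [hasFiniteIntegral_iff_ofReal (Eventually.of_forall fun x => sq_nonneg _)]
  have h1 : (volume.withDensity fun x => ENNReal.ofReal (w x ^ 2)) univ ≤ m univ := by
    rw [h.eq_add]; exact Measure.le_add_right le_rfl _
  rw [withDensity_apply _ MeasurableSet.univ, Measure.restrict_univ] at h1
  exact h1.trans_lt (measure_lt_top _ _)

lemma memLp_w (h : IsEnergyDatum u w m σ N) : MemLp w 2 volume :=
  (memLp_two_iff_integrable_sq h.measurable_w.aestronglyMeasurable).2 h.integrable_sq

lemma locallyIntegrable_w (h : IsEnergyDatum u w m σ N) : LocallyIntegrable w volume :=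
  h.memLp_w.locallyIntegrable (by norm_num)

lemma measurable_lebDensity (h : IsEnergyDatum u w m σ N) : Measurable (lebDensity w N) := by
  have := h.measurable_w
  exact Measurable.indicator (by fun_prop) h.measurableSet_N.compl

lemma lebDensity_ae (h : IsEnergyDatum u w m σ N) :
    ∀ᵐ x ∂volume, lebDensity w N x = 1 / (1 + w x ^ 2) := by
  have : ∀ᵐ x ∂(volume : Measure ℝ), x ∈ Nᶜ := by
    rw [ae_iff]; simpa using h.volume_N
  filter_upwards [this] with x hx
  rw [lebDensity, indicator_of_mem hx]

lemma lebDensity_ae_sing (h : IsEnergyDatum u w m σ N) : ∀ᵐ x ∂σ, lebDensity w N x = 0 := by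
  have : ∀ᵐ x ∂σ, x ∈ N := by
    rw [ae_iff]; exact h.sing_compl
  filter_upwards [this] with x hx
  rw [lebDensity, indicator_of_notMem (by simpa using hx)]

lemma withDensity_lebDensity (h : IsEnergyDatum u w m σ N) :
    (volume + m).withDensity (fun x => ENNReal.ofReal (lebDensity w N x)) = volume := by
  have mk := h.measurable_lebDensity.ennreal_ofReal
  have mw := (h.measurable_w.pow_const 2).ennreal_ofReal
  have hs : σ.withDensity (fun x => ENNReal.ofReal (lebDensity w N x)) = 0 := by
    rw [withDensity_eq_zero_iff mk.aemeasurable]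
    filter_upwards [h.lebDensity_ae_sing] with x hx
    simp [hx]
  conv_lhs => rw [h.eq_add]
  rw [withDensity_add_measure, withDensity_add_measure, hs, add_zero, ← withDensity_mul _ mw mk,
    ← withDensity_add_left mk]
  conv_rhs => rw [← withDensity_one (μ := (volume : Measure ℝ))]
  refine withDensity_congr_ae ?_
  filter_upwards [h.lebDensity_ae] with x hx
  simp only [Pi.add_apply, Pi.mul_apply, Pi.one_apply]
  rw [← ENNReal.ofReal_mul (sq_nonneg _), ← ENNReal.ofReal_add (lebDensity_nonneg _ _ _)
    (mul_nonneg (sq_nonneg _) (lebDensity_nonneg _ _ _)), hx, ENNReal.ofReal_eq_one]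
  field_simp

lemma withDensity_one_sub_lebDensity (h : IsEnergyDatum u w m σ N) :
    (volume + m).withDensity (fun x => ENNReal.ofReal (1 - lebDensity w N x)) = m := by
  have mk : Measurable fun x => ENNReal.ofReal (1 - lebDensity w N x) :=
    (measurable_const.sub h.measurable_lebDensity).ennreal_ofReal
  have mw := (h.measurable_w.pow_const 2).ennreal_ofReal
  have hs : σ.withDensity (fun x => ENNReal.ofReal (1 - lebDensity w N x)) = σ := by
    conv_rhs => rw [← withDensity_one (μ := σ)]
    refine withDensity_congr_ae ?_
    filter_upwards [h.lebDensity_ae_sing] with x hx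
    simp [hx]
  conv_lhs => rw [h.eq_add]
  rw [withDensity_add_measure, withDensity_add_measure, hs, ← withDensity_mul _ mw mk, ← add_assoc,
    ← withDensity_add_left mk, h.eq_add]
  congr 1
  refine withDensity_congr_ae ?_
  filter_upwards [h.lebDensity_ae] with x hx
  have h0 := lebDensity_le_one w N x
  simp only [Pi.add_apply, Pi.mul_apply]
  rw [← ENNReal.ofReal_mul (sq_nonneg _), ← ENNReal.ofReal_add (by linarith)
    (mul_nonneg (sq_nonneg _) (by linarith)), hx]
  congr 1
  field_simp; ring

/-- The measure `y_ξ dξ`, where `y_ξ` is the density of Lebesgue measure evaluated along `y`, is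
pushed forward by `y` to Lebesgue measure. -/
lemma map_charY_withDensity (h : IsEnergyDatum u w m σ N) :
    (volume.withDensity fun ξ => ENNReal.ofReal (lebDensity w N (charY m ξ))).map (charY m)
      = volume := by
  have := h.finite
  have mk := h.measurable_lebDensity.ennreal_ofReal
  have my := (charY_mono m).measurable
  ext A hA
  rw [Measure.map_apply my hA, withDensity_apply _ (my hA),
    ← setLIntegral_map hA mk my, map_charY_volume, ← withDensity_apply _ hA,
    h.withDensity_lebDensity]

/-- Change of variables along the characteristic. -/
lemma integral_comp_charY (h : IsEnergyDatum u w m σ N) {g : ℝ → ℝ} (hg : Measurable g) (a b : ℝ) :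
    ∫ ξ in a..b, g (charY m ξ) * lebDensity w N (charY m ξ)
      = ∫ x in charY m a..charY m b, g x := by
  have := h.finite
  have my := (charY_mono m).measurable
  have mk : Measurable fun ξ => ENNReal.ofReal (lebDensity w N (charY m ξ)) :=
    (h.measurable_lebDensity.comp my).ennreal_ofReal
  wlog hab : a ≤ b generalizing a b
  · rw [intervalIntegral.integral_symm, this b a (not_le.1 hab).le,
      ← intervalIntegral.integral_symm]
  rw [intervalIntegral.integral_of_le hab, intervalIntegral.integral_of_le (charY_mono m hab)]
  set κ := volume.withDensity fun ξ => ENNReal.ofReal (lebDensity w N (charY m ξ)) with hκ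
  have hmap : κ.map (charY m) = volume := h.map_charY_withDensity
  have h1 : ∫ ξ in Ioc a b, g (charY m ξ) * lebDensity w N (charY m ξ)
      = ∫ ξ in Ioc a b, g (charY m ξ) ∂κ := by
    rw [hκ, setIntegral_withDensity_eq_setIntegral_toReal_smul mk
      (Eventually.of_forall fun _ => ENNReal.ofReal_lt_top) _ measurableSet_Ioc]
    refine integral_congr_ae (Eventually.of_forall fun ξ => ?_)
    simp only [ENNReal.toReal_ofReal (lebDensity_nonneg _ _ _), smul_eq_mul, mul_comm]
  have h2 : ∀ x, ∀ᵐ ξ ∂κ, charY m ξ ≠ x := fun x => by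
    rw [ae_iff]
    have : κ (charY m ⁻¹' {x}) = 0 := by
      rw [← Measure.map_apply my (measurableSet_singleton x), hmap]; simp
    convert this using 2
    ext ξ; simp
  -- the level sets of `y` through `a` and `b` may be intervals, but `y_ξ dξ` does not charge them
  have h3 : Ioc a b =ᵐ[κ] charY m ⁻¹' Ioc (charY m a) (charY m b) := by
    filter_upwards [h2 (charY m a), h2 (charY m b)] with ξ ha hb
    refine propext ?_
    change (a < ξ ∧ ξ ≤ b) ↔ (_ < charY m ξ ∧ charY m ξ ≤ _)
    constructor
    · exact fun h' => ⟨lt_of_le_of_ne (charY_mono m h'.1.le) ha.symm, charY_mono m h'.2⟩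
    · exact fun h' => ⟨(charY_mono m).reflect_lt h'.1,
        ((charY_mono m).reflect_lt (lt_of_le_of_ne h'.2 hb)).le⟩
  rw [h1, setIntegral_congr_set h3]
  conv_rhs => rw [← hmap]
  rw [setIntegral_map measurableSet_Ioc hg.aestronglyMeasurable my.aemeasurable]

lemma charY_sub (h : IsEnergyDatum u w m σ N) (a b : ℝ) :
    charY m b - charY m a = ∫ ξ in a..b, lebDensity w N (charY m ξ) := by
  have := h.integral_comp_charY (measurable_const (a := (1 : ℝ))) a b
  simpa using this.symm

lemma comp_charY_sub (h : IsEnergyDatum u w m σ N) (a b : ℝ) :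
    u (charY m b) - u (charY m a) = ∫ ξ in a..b, w (charY m ξ) * lebDensity w N (charY m ξ) := by
  rw [h.sub_eq, h.integral_comp_charY h.measurable_w]

lemma deriv_charY_ae (h : IsEnergyDatum u w m σ N) :
    deriv (charY m) =ᵐ[volume] fun ξ => lebDensity w N (charY m ξ) := by
  have := h.finite
  refine deriv_ae_eq_of_sub_eq (locallyIntegrable_of_abs_le_one
    (h.measurable_lebDensity.comp (charY_mono m).measurable) fun ξ => ?_) h.charY_sub
  rw [abs_of_nonneg (lebDensity_nonneg _ _ _)]
  exact lebDensity_le_one _ _ _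

lemma deriv_charH_ae (h : IsEnergyDatum u w m σ N) :
    deriv (charH m) =ᵐ[volume] fun ξ => 1 - lebDensity w N (charY m ξ) := by
  have := h.finite
  filter_upwards [h.deriv_charY_ae, (lipschitzWith_charY m).ae_differentiableAt_real] with ξ h1 h2
  rw [← h1]
  exact ((hasDerivAt_id ξ).sub h2.hasDerivAt).deriv

lemma deriv_comp_charY_ae (h : IsEnergyDatum u w m σ N) :
    deriv (fun ξ => u (charY m ξ))
      =ᵐ[volume] fun ξ => w (charY m ξ) * lebDensity w N (charY m ξ) := by
  have := h.finite
  exact deriv_ae_eq_of_sub_eq (locallyIntegrable_of_abs_le_one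
    ((h.measurable_w.mul h.measurable_lebDensity).comp (charY_mono m).measurable)
    fun ξ => abs_mul_lebDensity_le _ _ _) h.comp_charY_sub

lemma lipschitzWith_comp_charY (h : IsEnergyDatum u w m σ N) :
    LipschitzWith 1 fun ξ => u (charY m ξ) :=
  lipschitzWith_one_of_sub_eq (fun _ => abs_mul_lebDensity_le _ _ _) h.comp_charY_sub

/-! ### Energy identities in Lagrangian coordinates -/

lemma measurable_lebDensity_comp (h : IsEnergyDatum u w m σ N) :
    Measurable fun ξ => lebDensity w N (charY m ξ) := by
  have := h.finite
  exact h.measurable_lebDensity.comp (charY_mono m).measurable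

lemma lintegral_one_sub (h : IsEnergyDatum u w m σ N) :
    ∫⁻ ξ, ENNReal.ofReal (1 - lebDensity w N (charY m ξ)) = m univ := by
  have := h.finite
  have mk : Measurable fun x => ENNReal.ofReal (1 - lebDensity w N x) :=
    (measurable_const.sub h.measurable_lebDensity).ennreal_ofReal
  rw [← lintegral_map (f := fun x => ENNReal.ofReal (1 - lebDensity w N x)) mk
    (charY_mono m).measurable, map_charY_volume]
  conv_rhs => rw [← h.withDensity_one_sub_lebDensity]
  rw [withDensity_apply _ MeasurableSet.univ, Measure.restrict_univ]

lemma integrable_one_sub (h : IsEnergyDatum u w m σ N) :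
    Integrable fun ξ => 1 - lebDensity w N (charY m ξ) := by
  have := h.finite
  refine ⟨(measurable_const.sub h.measurable_lebDensity_comp).aestronglyMeasurable, ?_⟩
  rw [hasFiniteIntegral_iff_ofReal
    (Eventually.of_forall fun ξ => sub_nonneg.2 (lebDensity_le_one _ _ _)), h.lintegral_one_sub]
  exact measure_lt_top _ _

lemma integral_one_sub (h : IsEnergyDatum u w m σ N) :
    ∫ ξ, (1 - lebDensity w N (charY m ξ)) = m.real univ := by
  rw [integral_eq_lintegral_of_nonneg_ae
    (Eventually.of_forall fun ξ => sub_nonneg.2 (lebDensity_le_one _ _ _))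
    (measurable_const.sub h.measurable_lebDensity_comp).aestronglyMeasurable,
    h.lintegral_one_sub, measureReal_def]

lemma integrable_one_sub_mul (h : IsEnergyDatum u w m σ N) :
    Integrable fun ξ => (1 - lebDensity w N (charY m ξ)) * lebDensity w N (charY m ξ) := by
  refine h.integrable_one_sub.mono
    ((measurable_const.sub h.measurable_lebDensity_comp).mul
      h.measurable_lebDensity_comp).aestronglyMeasurable (Eventually.of_forall fun ξ => ?_)
  rw [norm_mul, Real.norm_of_nonneg (lebDensity_nonneg _ _ _)]
  exact mul_le_of_le_one_right (norm_nonneg _) (lebDensity_le_one _ _ _)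

/-- `∫ y_ξ H_ξ dξ = ∫ w² / (1 + w²) dx`: the singular part of the energy does not contribute. -/
lemma integral_one_sub_mul (h : IsEnergyDatum u w m σ N) :
    ∫ ξ, (1 - lebDensity w N (charY m ξ)) * lebDensity w N (charY m ξ) = regEnergy w := by
  have := h.finite
  have my := (charY_mono m).measurable
  have mk := h.measurable_lebDensity_comp.ennreal_ofReal
  have h1 := integral_withDensity_eq_integral_toReal_smul (μ := volume) mk
    (Eventually.of_forall fun _ => ENNReal.ofReal_lt_top)
    (fun ξ => 1 - lebDensity w N (charY m ξ))
  simp only [ENNReal.toReal_ofReal (lebDensity_nonneg _ _ _), smul_eq_mul] at h1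
  simp_rw [mul_comm (1 - lebDensity w N _)]
  rw [← h1, ← integral_map (φ := charY m) (f := fun x => 1 - lebDensity w N x) my.aemeasurable
    (measurable_const.sub h.measurable_lebDensity).aestronglyMeasurable,
    h.map_charY_withDensity, regEnergy]
  refine integral_congr_ae ?_
  filter_upwards [h.lebDensity_ae] with x hx
  rw [hx]; field_simp; ring

lemma sq_deriv_comp_charY_ae (h : IsEnergyDatum u w m σ N) :
    (fun ξ => deriv (fun ξ => u (charY m ξ)) ξ ^ 2) =ᵐ[volume]
      fun ξ => (1 - lebDensity w N (charY m ξ)) * lebDensity w N (charY m ξ) := by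
  filter_upwards [h.deriv_comp_charY_ae] with ξ hξ
  rw [hξ, mul_pow, sq_mul_lebDensity_sq]

lemma integral_sq_deriv_comp_charY (h : IsEnergyDatum u w m σ N) :
    ∫ ξ, deriv (fun ξ => u (charY m ξ)) ξ ^ 2 = regEnergy w := by
  rw [integral_congr_ae h.sq_deriv_comp_charY_ae, h.integral_one_sub_mul]

lemma memLp_deriv_comp_charY (h : IsEnergyDatum u w m σ N) :
    MemLp (deriv fun ξ => u (charY m ξ)) 2 volume :=
  (memLp_two_iff_integrable_sq (measurable_deriv _).aestronglyMeasurable).2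
    (h.integrable_one_sub_mul.congr h.sq_deriv_comp_charY_ae.symm)

lemma integrable_deriv_charH (h : IsEnergyDatum u w m σ N) : Integrable (deriv (charH m)) :=
  h.integrable_one_sub.congr h.deriv_charH_ae.symm

lemma integral_deriv_charH (h : IsEnergyDatum u w m σ N) :
    ∫ ξ, deriv (charH m) ξ = m.real univ := by
  rw [integral_congr_ae h.deriv_charH_ae, h.integral_one_sub]

lemma sq_deriv_charH_ae (h : IsEnergyDatum u w m σ N) :
    (fun ξ => deriv (charH m) ξ ^ 2) =ᵐ[volume] fun ξ => (1 - lebDensity w N (charY m ξ))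
      - (1 - lebDensity w N (charY m ξ)) * lebDensity w N (charY m ξ) := by
  filter_upwards [h.deriv_charH_ae] with ξ hξ
  rw [hξ]; ring

lemma integral_sq_deriv_charH (h : IsEnergyDatum u w m σ N) :
    ∫ ξ, deriv (charH m) ξ ^ 2 = m.real univ - regEnergy w := by
  rw [integral_congr_ae h.sq_deriv_charH_ae,
    integral_sub h.integrable_one_sub h.integrable_one_sub_mul, h.integral_one_sub,
    h.integral_one_sub_mul]

lemma memLp_deriv_charH (h : IsEnergyDatum u w m σ N) : MemLp (deriv (charH m)) 2 volume :=
  (memLp_two_iff_integrable_sq (measurable_deriv _).aestronglyMeasurable).2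
    ((h.integrable_one_sub.sub h.integrable_one_sub_mul).congr h.sq_deriv_charH_ae.symm)

lemma deriv_charH_nonneg_ae (h : IsEnergyDatum u w m σ N) :
    ∀ᵐ ξ ∂volume, 0 ≤ deriv (charH m) ξ := by
  filter_upwards [h.deriv_charH_ae] with ξ hξ
  rw [hξ]; exact sub_nonneg.2 (lebDensity_le_one _ _ _)

lemma hasRegularDerivs (h : IsEnergyDatum u w m σ N) (μ : Measure ℝ) :
    HasRegularDerivs (toLagrange ⟨u, μ, m⟩) := by
  have := h.finite
  exact ⟨⟨1, lipschitzWith_charY m⟩, ⟨1, h.lipschitzWith_comp_charY⟩, ⟨1, lipschitzWith_charH m⟩,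
    h.memLp_deriv_comp_charY, memLp_one_iff_integrable.2 h.integrable_deriv_charH,
    h.memLp_deriv_charH⟩

end IsEnergyDatum

/-! ### From convergence of norms to strong convergence -/

section StrongConvergence

lemma lineDeriv_real_one (f : ℝ → ℝ) (x : ℝ) : lineDeriv ℝ f x 1 = deriv f x := by
  rw [lineDeriv]
  have := deriv_comp_const_add (f := f) x 0
  simpa using this

lemma lineDeriv_real_neg_one (f : ℝ → ℝ) (x : ℝ) : lineDeriv ℝ f x (-1) = -deriv f x := by
  rw [lineDeriv_neg, lineDeriv_real_one]

lemma integral_deriv_mul_of_lipschitzWith {f g : ℝ → ℝ} (hf : LipschitzWith 1 f)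
    (hg : ContDiff ℝ ∞ g) (hc : HasCompactSupport g) :
    ∫ x, deriv f x * g x = -∫ x, deriv g x * f x := by
  obtain ⟨D, hD⟩ := hg.lipschitzWith_of_hasCompactSupport hc (by simp)
  have := LipschitzWith.integral_lineDeriv_mul_eq (μ := volume) hf hD hc 1
  simpa only [lineDeriv_real_one, lineDeriv_real_neg_one, neg_mul, integral_neg] using this

variable {ι : Type*} {l : Filter ι}

lemma tendsto_integral_deriv_mul [l.IsCountablyGenerated] {F : ι → ℝ → ℝ} {f g : ℝ → ℝ}
    (hF : ∀ᶠ i in l, LipschitzWith 1 (F i)) (hf : LipschitzWith 1 f)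
    (hlim : ∀ x, Tendsto (fun i => F i x) l (𝓝 (f x)))
    (hg : ContDiff ℝ ∞ g) (hc : HasCompactSupport g) :
    Tendsto (fun i => ∫ x, deriv (F i) x * g x) l (𝓝 (∫ x, deriv f x * g x)) := by
  rw [integral_deriv_mul_of_lipschitzWith hf hg hc]
  have hcd : Continuous (deriv g) := hg.continuous_deriv (by simp)
  have key : Tendsto (fun i => ∫ x, deriv g x * F i x) l (𝓝 (∫ x, deriv g x * f x)) := by
    refine tendsto_integral_filter_of_dominated_convergence
      (fun x => |deriv g x| * (|f 0| + 1 + |x|)) ?_ ?_ ?_ ?_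
    · filter_upwards [hF] with i hi
      exact (hcd.mul hi.continuous).aestronglyMeasurable
    · have h0 : ∀ᶠ i in l, |F i 0 - f 0| < 1 := by
        have := (hlim 0).eventually (Metric.ball_mem_nhds (f 0) one_pos)
        simpa [Real.dist_eq] using this
      filter_upwards [hF, h0] with i hi h0
      refine Eventually.of_forall fun x => ?_
      have h1 := hi.dist_le_mul x 0
      simp only [Real.dist_eq, NNReal.coe_one, one_mul, sub_zero] at h1
      rw [norm_mul, Real.norm_eq_abs, Real.norm_eq_abs]
      refine mul_le_mul_of_nonneg_left ?_ (abs_nonneg _)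
      have h2 : F i x = f 0 + (F i 0 - f 0) + (F i x - F i 0) := by ring
      rw [h2]
      refine (abs_add_three _ _ _).trans ?_
      linarith
    · have hc' : HasCompactSupport fun x => |deriv g x| * (|f 0| + 1 + |x|) := by
        refine HasCompactSupport.mul_right ?_
        exact hc.deriv.comp_left abs_zero
      exact Continuous.integrable_of_hasCompactSupport (by fun_prop) hc'
    · exact Eventually.of_forall fun x => (hlim x).const_mul _
  refine key.neg.congr' ?_
  filter_upwards [hF] with i hi
  rw [integral_deriv_mul_of_lipschitzWith hi hg hc]

lemma eLpNorm_two_eq_ofReal_sqrt {f : ℝ → ℝ} (hf : MemLp f 2 volume) :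
    eLpNorm f 2 volume = ENNReal.ofReal (√(∫ x, f x ^ 2)) := by
  rw [hf.eLpNorm_eq_integral_rpow_norm (by norm_num) (by norm_num)]
  congr 1
  rw [Real.sqrt_eq_rpow]
  norm_num

/-- The squared `L²` distance of `f` and `a`, estimated through a third function `g`. -/
lemma integral_sq_sub_le {f a g : ℝ → ℝ} (hf : MemLp f 2 volume) (ha : MemLp a 2 volume)
    (hg : MemLp g 2 volume) :
    ∫ x, (a x - f x) ^ 2 ≤ 2 * (∫ x, a x ^ 2) - 2 * (∫ x, f x ^ 2)
      - 4 * ((∫ x, a x * g x) - ∫ x, f x * g x) + 4 * (∫ x, (f x - g x) ^ 2) := by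
  have ia := ha.integrable_sq
  have iF := hf.integrable_sq
  have iag : Integrable fun x => a x * g x := ha.integrable_mul hg
  have ifg : Integrable fun x => f x * g x := hf.integrable_mul hg
  have iga : Integrable fun x => (f x - g x) ^ 2 := (hf.sub hg).integrable_sq
  have iaf : Integrable fun x => (a x - f x) ^ 2 := (ha.sub hf).integrable_sq
  have i1 : Integrable fun x => 2 * a x ^ 2 - 2 * f x ^ 2 := (ia.const_mul 2).sub (iF.const_mul 2)
  have i2 : Integrable fun x => 4 * (a x * g x - f x * g x) := (iag.sub ifg).const_mul 4
  have i3 : Integrable fun x => 2 * a x ^ 2 - 2 * f x ^ 2 - 4 * (a x * g x - f x * g x) :=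
    i1.sub i2
  have e : 2 * (∫ x, a x ^ 2) - 2 * (∫ x, f x ^ 2)
      - 4 * ((∫ x, a x * g x) - ∫ x, f x * g x) + 4 * (∫ x, (f x - g x) ^ 2)
      = ∫ x, (2 * a x ^ 2 - 2 * f x ^ 2 - 4 * (a x * g x - f x * g x) + 4 * (f x - g x) ^ 2) := by
    rw [integral_add i3 (iga.const_mul 4), integral_sub i1 i2, integral_sub (ia.const_mul 2)
      (iF.const_mul 2), integral_const_mul, integral_const_mul, integral_const_mul,
      integral_const_mul, integral_sub iag ifg]
  rw [e]
  refine integral_mono iaf (i3.add (iga.const_mul 4)) fun x => ?_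
  change (a x - f x) ^ 2 ≤ 2 * a x ^ 2 - 2 * f x ^ 2 - 4 * (a x * g x - f x * g x)
    + 4 * (f x - g x) ^ 2
  -- the difference of the two sides is `(a + f - 2 g)²`
  nlinarith [sq_nonneg (a x + f x - 2 * g x)]

/-- The Radon–Riesz property for derivatives of Lipschitz functions: pointwise convergence of the
functions gives weak convergence of the derivatives, which together with convergence of the
`L²` norms is strong convergence. -/
lemma tendsto_integral_sq_deriv_sub [l.IsCountablyGenerated] {F : ι → ℝ → ℝ} {f : ℝ → ℝ}
    (hF : ∀ᶠ i in l, LipschitzWith 1 (F i)) (hf : LipschitzWith 1 f)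
    (hlim : ∀ x, Tendsto (fun i => F i x) l (𝓝 (f x)))
    (hF2 : ∀ᶠ i in l, MemLp (deriv (F i)) 2 volume) (hf2 : MemLp (deriv f) 2 volume)
    (hnorm : Tendsto (fun i => ∫ x, deriv (F i) x ^ 2) l (𝓝 (∫ x, deriv f x ^ 2))) :
    Tendsto (fun i => ∫ x, (deriv (F i) x - deriv f x) ^ 2) l (𝓝 0) := by
  rw [Metric.tendsto_nhds]
  intro ε hε
  obtain ⟨g, hgc, hg, hgε⟩ := hf2.exist_eLpNorm_sub_le (by norm_num) (by norm_num)
    (show 0 < √(ε / 8) by positivity)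
  have hg2 : MemLp g 2 volume := hg.continuous.memLp_of_hasCompactSupport hgc
  have hgε' : ∫ x, (deriv f x - g x) ^ 2 ≤ ε / 8 := by
    rw [eLpNorm_two_eq_ofReal_sqrt (hf2.sub hg2),
      ENNReal.ofReal_le_ofReal_iff (Real.sqrt_nonneg _)] at hgε
    exact (Real.sqrt_le_sqrt_iff (by positivity)).1 hgε
  have hw := tendsto_integral_deriv_mul hF hf hlim hg hgc
  have h1 : Tendsto (fun i => 2 * (∫ x, deriv (F i) x ^ 2) - 2 * (∫ x, deriv f x ^ 2)
      - 4 * ((∫ x, deriv (F i) x * g x) - ∫ x, deriv f x * g x)) l (𝓝 0) := by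
    have := ((hnorm.const_mul 2).sub_const (2 * ∫ x, deriv f x ^ 2)).sub
      ((hw.sub_const (∫ x, deriv f x * g x)).const_mul 4)
    simpa using this
  filter_upwards [h1.eventually (gt_mem_nhds (half_pos hε)), hF2] with i hi hi2
  rw [Real.dist_eq, sub_zero, abs_of_nonneg (integral_nonneg fun x => sq_nonneg _)]
  have := integral_sq_sub_le hf2 hi2 hg2
  linarith

lemma tendsto_eLpNorm_two_of_integral_sq {F : ι → ℝ → ℝ} (hF : ∀ᶠ i in l, MemLp (F i) 2 volume)
    (h : Tendsto (fun i => ∫ x, F i x ^ 2) l (𝓝 0)) :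
    Tendsto (fun i => eLpNorm (F i) 2 volume) l (𝓝 0) := by
  have h1 := ENNReal.tendsto_ofReal h.sqrt
  rw [Real.sqrt_zero, ENNReal.ofReal_zero] at h1
  refine h1.congr' ?_
  filter_upwards [hF] with i hi
  rw [eLpNorm_two_eq_ofReal_sqrt hi]

/-- For nonnegative functions with convergent masses, `L²` convergence implies `L¹` convergence: it
suffices to control the negative part of `F i - f`, which is dominated by `f`. -/
lemma tendsto_eLpNorm_one_of_integral_sq {F : ι → ℝ → ℝ} {f : ℝ → ℝ}
    (hF : ∀ᶠ i in l, Integrable (F i) ∧ MemLp (F i) 2 volume ∧ ∀ᵐ x ∂volume, 0 ≤ F i x)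
    (hf : Integrable f) (hf2 : MemLp f 2 volume) (hf0 : ∀ᵐ x ∂volume, 0 ≤ f x)
    (hmass : Tendsto (fun i => ∫ x, F i x) l (𝓝 (∫ x, f x)))
    (h : Tendsto (fun i => ∫ x, (F i x - f x) ^ 2) l (𝓝 0)) :
    Tendsto (fun i => eLpNorm (fun x => F i x - f x) 1 volume) l (𝓝 0) := by
  have hmin : Tendsto (fun δ : ℝ => ∫ x, min δ (f x)) (𝓝[>] 0) (𝓝 0) := by
    have : Tendsto (fun δ : ℝ => ∫ x, min δ (f x)) (𝓝[>] 0) (𝓝 (∫ _ : ℝ, (0 : ℝ))) := by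
      refine tendsto_integral_filter_of_dominated_convergence f ?_ ?_ hf ?_
      · exact Eventually.of_forall fun δ => aestronglyMeasurable_const.inf hf.1
      · filter_upwards [self_mem_nhdsWithin] with δ (hδ : 0 < δ)
        filter_upwards [hf0] with x hx
        rw [Real.norm_of_nonneg (le_min hδ.le hx)]
        exact min_le_right _ _
      · filter_upwards [hf0] with x hx
        have : Tendsto (fun δ : ℝ => min δ (f x)) (𝓝 0) (𝓝 (min 0 (f x))) :=
          (continuous_id.min continuous_const).tendsto 0
        rw [min_eq_left hx] at this
        exact this.mono_left nhdsWithin_le_nhds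
    simpa using this
  have key : Tendsto (fun i => ∫ x, |F i x - f x|) l (𝓝 0) := by
    rw [Metric.tendsto_nhds]
    intro ε hε
    obtain ⟨δ, hδε, hδ⟩ := ((hmin.eventually (gt_mem_nhds (by positivity : (0 : ℝ) < ε / 6))).and
      self_mem_nhdsWithin).exists
    have hδ : 0 < δ := hδ
    have h1 := h.eventually (gt_mem_nhds (by positivity : (0 : ℝ) < δ * (ε / 6)))
    have h2 : ∀ᶠ i in l, ∫ x, F i x < (∫ x, f x) + ε / 6 :=
      hmass.eventually (gt_mem_nhds (by linarith))
    filter_upwards [hF, h1, h2] with i ⟨hi1, hi2, hi0⟩ h1 h2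
    rw [Real.dist_eq, sub_zero, abs_of_nonneg (integral_nonneg fun x => abs_nonneg _)]
    have isq : Integrable fun x => (F i x - f x) ^ 2 := (hi2.sub hf2).integrable_sq
    have imin : Integrable fun x => min δ (f x) := by
      refine hf.mono (aestronglyMeasurable_const.inf hf.1) ?_
      filter_upwards [hf0] with x hx
      rw [Real.norm_of_nonneg (le_min hδ.le hx), Real.norm_of_nonneg hx]
      exact min_le_right _ _
    have isub : Integrable fun x => F i x - f x := hi1.sub hf
    have iadd : Integrable fun x => (F i x - f x) ^ 2 / δ + min δ (f x) :=
      (isq.div_const δ).add imin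
    have hle : ∫ x, |F i x - f x| ≤
        ∫ x, ((F i x - f x) + 2 * ((F i x - f x) ^ 2 / δ + min δ (f x))) := by
      refine integral_mono_ae isub.abs (isub.add (iadd.const_mul 2)) ?_
      filter_upwards [hi0, hf0] with x hx0 hx
      have hq : 0 ≤ (F i x - f x) ^ 2 / δ := by positivity
      have hm : 0 ≤ min δ (f x) := le_min hδ.le hx
      change |F i x - f x| ≤ (F i x - f x) + 2 * ((F i x - f x) ^ 2 / δ + min δ (f x))
      rcases abs_cases (F i x - f x) with ⟨e, _⟩ | ⟨e, _⟩
      · rw [e]; linarith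
      · -- the negative part is at most `f`; where it exceeds `δ` the quadratic term dominates it
        rw [e]
        suffices f x - F i x ≤ (F i x - f x) ^ 2 / δ + min δ (f x) by linarith
        rcases le_total δ (f x - F i x) with hc | hc
        · have : f x - F i x ≤ (F i x - f x) ^ 2 / δ := by
            rw [le_div_iff₀ hδ]; nlinarith
          linarith
        · have : f x - F i x ≤ min δ (f x) := le_min hc (by linarith)
          linarith
    have heq : ∫ x, ((F i x - f x) + 2 * ((F i x - f x) ^ 2 / δ + min δ (f x)))
        = ((∫ x, F i x) - ∫ x, f x)
          + 2 * ((∫ x, (F i x - f x) ^ 2) / δ + ∫ x, min δ (f x)) := by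
      rw [integral_add isub (iadd.const_mul 2),
        integral_sub hi1 hf, integral_const_mul, integral_add (isq.div_const δ) imin,
        integral_div]
    have h3 : (∫ x, (F i x - f x) ^ 2) / δ < ε / 6 := by
      rw [div_lt_iff₀ hδ]; linarith
    linarith
  have h1 := ENNReal.tendsto_ofReal key
  rw [ENNReal.ofReal_zero] at h1
  refine h1.congr' ?_
  filter_upwards [hF] with i ⟨hi1, _, _⟩
  have isub : Integrable fun x => F i x - f x := hi1.sub hf
  rw [eLpNorm_one_eq_lintegral_enorm, ← ofReal_integral_norm_eq_lintegral_enorm isub]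
  rfl

end StrongConvergence

/-! ### The projected data -/

lemma grid_odd (Δ : ℝ) (j : ℤ) : grid Δ (2 * j + 1) = grid Δ (2 * j) + Δ := by
  simp only [grid]; push_cast; ring

lemma grid_even_succ (Δ : ℝ) (j : ℤ) : grid Δ (2 * j + 2) = grid Δ (2 * j) + 2 * Δ := by
  simp only [grid]; push_cast; ring

lemma grid_even_strictMono {Δ : ℝ} (hΔ : 0 < Δ) : StrictMono fun j : ℤ => grid Δ (2 * j) := by
  intro i j hij
  have : (i : ℝ) < j := by exact_mod_cast hij
  simp only [grid]; push_cast; nlinarith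

lemma measurable_cellFloor (Δ : ℝ) : Measurable fun x : ℝ => ⌊x / (2 * Δ)⌋ :=
  Int.measurable_floor.comp (measurable_id.div_const _)

lemma measurable_comp_cellFloor (Δ : ℝ) (f : ℤ → ℝ) : Measurable fun x : ℝ => f ⌊x / (2 * Δ)⌋ :=
  (measurable_from_top (f := f)).comp (measurable_cellFloor Δ)

lemma cellFloor_preimage_singleton {Δ : ℝ} (hΔ : 0 < Δ) (j : ℤ) :
    (fun x : ℝ => ⌊x / (2 * Δ)⌋) ⁻¹' {j} = Ico (grid Δ (2 * j)) (grid Δ (2 * j + 2)) := by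
  ext x
  exact ⟨fun h => mem_of_floor_eq hΔ h, fun h => floor_eq_of_mem hΔ h.1 h.2⟩

lemma cellFloor_preimage_Iio {Δ : ℝ} (hΔ : 0 < Δ) (j : ℤ) :
    (fun x : ℝ => ⌊x / (2 * Δ)⌋) ⁻¹' Iio j = Iio (grid Δ (2 * j)) := by
  have h2Δ : 0 < 2 * Δ := by linarith
  ext x
  simp only [mem_preimage, mem_Iio, Int.floor_lt, div_lt_iff₀ h2Δ, grid]
  push_cast
  constructor <;> intro h <;> linarith

lemma mem_cellIdx {Δ : ℝ} (hΔ : 0 < Δ) (x : ℝ) :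
    grid Δ (2 * cellIdx Δ x) < x ∧ x ≤ grid Δ (2 * cellIdx Δ x + 2) := by
  have h2Δ : 0 < 2 * Δ := by linarith
  have h1 : x / (2 * Δ) ≤ ((cellIdx Δ x + 1 : ℤ) : ℝ) := by
    rw [cellIdx, sub_add_cancel]; exact Int.le_ceil _
  have h2 : ((cellIdx Δ x : ℤ) : ℝ) < x / (2 * Δ) := by
    rw [← Int.lt_ceil, cellIdx]; omega
  rw [div_le_iff₀ h2Δ] at h1
  rw [lt_div_iff₀ h2Δ] at h2
  simp only [grid]; push_cast at h1 ⊢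
  constructor <;> linarith

lemma cellIdx_eq {Δ : ℝ} (hΔ : 0 < Δ) {j : ℤ} {x : ℝ} (h1 : grid Δ (2 * j) < x)
    (h2 : x ≤ grid Δ (2 * j + 2)) : cellIdx Δ x = j := by
  have h3 : 0 < 2 * Δ := by linarith
  have : ⌈x / (2 * Δ)⌉ = j + 1 := by
    simp only [grid] at h1 h2
    push_cast at h1 h2
    rw [Int.ceil_eq_iff, lt_div_iff₀ h3, div_le_iff₀ h3]
    push_cast
    constructor <;> linarith
  rw [cellIdx, this]; ring

lemma sq_sign (e : ℤˣ) : ((e : ℤ) : ℝ) ^ 2 = 1 := by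
  rcases Int.units_eq_one_or e with h | h <;> simp [h]

section Measures

variable (Δ : ℝ) (s : ℤ → ℤˣ) (Z : EulerData)

lemma measurable_slopeFun : Measurable (slopeFun Δ s Z) :=
  Measurable.ite (measurableSet_lt measurable_id
      (measurable_comp_cellFloor Δ fun j => grid Δ (2 * j + 1)))
    (measurable_comp_cellFloor Δ (slopeL Δ s Z)) (measurable_comp_cellFloor Δ (slopeR Δ s Z))

/-- The absolutely continuous part of the projected measure. -/
noncomputable def projAc : Measure ℝ :=
  volume.withDensity fun x => ENNReal.ofReal (slopeFun Δ s Z x ^ 2)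

/-- The singular part of the projected measure: the singular mass of each double cell is moved to
the left end point of the cell. -/
noncomputable def projSing : Measure ℝ :=
  (singPart Z.μ).map fun x => grid Δ (2 * ⌊x / (2 * Δ)⌋)

variable {Δ} {s} {Z} {α : ℝ}

lemma slopeFun_eq_left (hΔ : 0 < Δ) {j : ℤ} {x : ℝ} (h1 : grid Δ (2 * j) ≤ x)
    (h2 : x < grid Δ (2 * j + 1)) : slopeFun Δ s Z x = slopeL Δ s Z j := by
  have := floor_eq_of_mem hΔ h1 (by rw [grid_even_succ]; rw [grid_odd] at h2; linarith)
  rw [slopeFun, this, if_pos h2]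

lemma slopeFun_eq_right (hΔ : 0 < Δ) {j : ℤ} {x : ℝ} (h1 : grid Δ (2 * j + 1) ≤ x)
    (h2 : x < grid Δ (2 * j + 2)) : slopeFun Δ s Z x = slopeR Δ s Z j := by
  have := floor_eq_of_mem hΔ (by rw [grid_odd] at h1; linarith) h2
  rw [slopeFun, this, if_neg (not_lt.2 h1)]

lemma projAc_Ico_left (hΔ : 0 < Δ) {j : ℤ} {y : ℝ} (hy : y ≤ grid Δ (2 * j + 1)) :
    projAc Δ s Z (Ico (grid Δ (2 * j)) y)
      = ENNReal.ofReal (slopeL Δ s Z j ^ 2 * (y - grid Δ (2 * j))) :=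
  withDensity_Ico_of_const fun _ hx => slopeFun_eq_left hΔ hx.1 (hx.2.trans_le hy)

lemma projAc_Ico (hΔ : 0 < Δ) {j : ℤ} {y : ℝ} (hy1 : grid Δ (2 * j + 1) ≤ y)
    (hy2 : y ≤ grid Δ (2 * j + 2)) :
    projAc Δ s Z (Ico (grid Δ (2 * j)) y) = ENNReal.ofReal (slopeL Δ s Z j ^ 2 * Δ
      + slopeR Δ s Z j ^ 2 * (y - grid Δ (2 * j + 1))) := by
  have hR : projAc Δ s Z (Ico (grid Δ (2 * j + 1)) y)
      = ENNReal.ofReal (slopeR Δ s Z j ^ 2 * (y - grid Δ (2 * j + 1))) :=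
    withDensity_Ico_of_const fun _ hx => slopeFun_eq_right hΔ hx.1 (hx.2.trans_le hy2)
  rw [← Ico_union_Ico_eq_Ico (by rw [grid_odd]; linarith) hy1,
    measure_union _ measurableSet_Ico, projAc_Ico_left hΔ le_rfl, hR,
    ENNReal.ofReal_add (by positivity) (mul_nonneg (sq_nonneg _) (by linarith)), grid_odd,
    add_sub_cancel_left]
  rw [disjoint_left]; intro x hx hx'; exact absurd hx'.1 (not_le.2 hx.2)

lemma isFiniteMeasure_acPart (hZ : MemD α Z) : IsFiniteMeasure (acPart Z.μ) :=
  have := hZ.finite_μ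
  isFiniteMeasure_of_le _ (acPart_le _)

lemma diffQ_mul (hΔ : 0 < Δ) (f : ℝ → ℝ) (j : ℤ) :
    diffQ Δ f j * (2 * Δ) = f (grid Δ (2 * j + 2)) - f (grid Δ (2 * j)) := by
  rw [diffQ]; field_simp

/-- The projection preserves the absolutely continuous energy of every double cell. -/
lemma map_cellFloor_projAc (hZ : MemD α Z) (hΔ : 0 < Δ) (s : ℤ → ℤˣ) :
    (projAc Δ s Z).map (fun x => ⌊x / (2 * Δ)⌋)
      = (acPart Z.μ).map fun x => ⌊x / (2 * Δ)⌋ := by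
  have := isFiniteMeasure_acPart hZ
  refine Measure.ext_of_singleton fun j => ?_
  rw [Measure.map_apply (measurable_cellFloor Δ) (measurableSet_singleton _),
    Measure.map_apply (measurable_cellFloor Δ) (measurableSet_singleton _),
    cellFloor_preimage_singleton hΔ,
    projAc_Ico hΔ (by rw [grid_odd, grid_even_succ]; linarith) le_rfl,
    ← ENNReal.ofReal_toReal (measure_ne_top (acPart Z.μ) _), ← measureReal_def,
    ← cdfLeft_sub _ (by rw [grid_even_succ]; linarith), ← diffQ_mul hΔ, grid_odd, grid_even_succ]
  congr 1
  simp only [slopeL, slopeR]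
  linear_combination (2 * Δ * ((s j : ℤ) : ℝ) ^ 2) * qCoef_sq hZ hΔ j
    + 2 * Δ * (diffQ Δ (cdfLeft (acPart Z.μ)) j - diffQ Δ Z.u j ^ 2) * sq_sign (s j)

lemma projAc_univ (hZ : MemD α Z) (hΔ : 0 < Δ) (s : ℤ → ℤˣ) :
    projAc Δ s Z univ = acPart Z.μ univ := by
  have h := congrArg (fun m : Measure ℤ => m univ) (map_cellFloor_projAc hZ hΔ s)
  simpa only [Measure.map_apply (measurable_cellFloor Δ) MeasurableSet.univ, preimage_univ] using h

lemma isFiniteMeasure_projAc (hZ : MemD α Z) (hΔ : 0 < Δ) (s : ℤ → ℤˣ) :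
    IsFiniteMeasure (projAc Δ s Z) := by
  have := isFiniteMeasure_acPart hZ
  exact ⟨by rw [projAc_univ hZ hΔ]; exact measure_lt_top _ _⟩

lemma cdfLeft_projAc_grid (hZ : MemD α Z) (hΔ : 0 < Δ) (s : ℤ → ℤˣ) (j : ℤ) :
    cdfLeft (projAc Δ s Z) (grid Δ (2 * j)) = cdfLeft (acPart Z.μ) (grid Δ (2 * j)) := by
  have h := congrArg (fun m : Measure ℤ => m (Iio j)) (map_cellFloor_projAc hZ hΔ s)
  simp only [Measure.map_apply (measurable_cellFloor Δ) measurableSet_Iio,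
    cellFloor_preimage_Iio hΔ] at h
  rw [cdfLeft, cdfLeft, measureReal_def, measureReal_def, h]

lemma cdfLeft_projAc (hZ : MemD α Z) (hΔ : 0 < Δ) (s : ℤ → ℤˣ) (x : ℝ) :
    cdfLeft (projAc Δ s Z) x = projFac Δ s Z x := by
  have := isFiniteMeasure_projAc hZ hΔ s
  obtain ⟨hx1, hx2⟩ := mem_cellIdx hΔ x
  have h1 := cdfLeft_sub (projAc Δ s Z) hx1.le
  rw [cdfLeft_projAc_grid hZ hΔ, measureReal_def] at h1
  simp only [projFac]
  set j := cellIdx Δ x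
  split_ifs with hc
  · rw [projAc_Ico_left hΔ hc, ENNReal.toReal_ofReal
      (mul_nonneg (sq_nonneg _) (by linarith))] at h1
    linarith
  · have hc := (not_le.1 hc).le
    rw [projAc_Ico hΔ hc hx2, ENNReal.toReal_ofReal (add_nonneg (by positivity)
      (mul_nonneg (sq_nonneg _) (by linarith)))] at h1
    have hq2 : slopeL Δ s Z j ^ 2 * Δ
        = (cdfLeft (acPart Z.μ) (grid Δ (2 * j + 2))
            - cdfLeft (acPart Z.μ) (grid Δ (2 * j))) / 2
          - 2 * ((s j : ℤ) : ℝ) * qCoef Δ Z j * diffQ Δ Z.u j * Δ := by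
      rw [← diffQ_mul hΔ]
      simp only [slopeL]
      linear_combination (Δ * ((s j : ℤ) : ℝ) ^ 2) * qCoef_sq hZ hΔ j
        + Δ * (diffQ Δ (cdfLeft (acPart Z.μ)) j - diffQ Δ Z.u j ^ 2) * sq_sign (s j)
    linarith

lemma measurable_gridFloor (Δ : ℝ) : Measurable fun x : ℝ => grid Δ (2 * ⌊x / (2 * Δ)⌋) :=
  measurable_comp_cellFloor Δ fun j => grid Δ (2 * j)

lemma cdfLeft_projSing (hΔ : 0 < Δ) (x : ℝ) : cdfLeft (projSing Δ Z) x = projFsing Δ Z x := by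
  obtain ⟨hx1, hx2⟩ := mem_cellIdx hΔ x
  rw [projFsing, cdfLeft, cdfLeft, measureReal_def, measureReal_def, projSing,
    Measure.map_apply (measurable_gridFloor Δ) measurableSet_Iio]
  congr 2
  ext z
  have e : ∀ j : ℤ, grid Δ (2 * j + 2) = grid Δ (2 * (j + 1)) := fun j => by congr 1; ring
  obtain ⟨hz1, hz2⟩ := mem_of_floor_eq hΔ (rfl : ⌊z / (2 * Δ)⌋ = ⌊z / (2 * Δ)⌋)
  rw [e] at hx2 hz2
  simp only [mem_preimage, mem_Iio]
  rw [e]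
  constructor
  · intro h
    have : ⌊z / (2 * Δ)⌋ < cellIdx Δ x + 1 :=
      (grid_even_strictMono hΔ).lt_iff_lt.1 (h.trans_le hx2)
    exact hz2.trans_le ((grid_even_strictMono hΔ).monotone (by omega))
  · intro h
    have : ⌊z / (2 * Δ)⌋ < cellIdx Δ x + 1 :=
      (grid_even_strictMono hΔ).lt_iff_lt.1 (hz1.trans_lt h)
    exact lt_of_le_of_lt ((grid_even_strictMono hΔ).monotone (by omega)) hx1

lemma isFiniteMeasure_projSing (hZ : MemD α Z) : IsFiniteMeasure (projSing Δ Z) := by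
  have := hZ.finite_μ
  have : IsFiniteMeasure (singPart Z.μ) :=
    isFiniteMeasure_of_le _ (Measure.singularPart_le _ _)
  rw [projSing]; infer_instance

/-- The measure chosen in the projection operator is the expected one. -/
lemma measureOfCdf_projF (hZ : MemD0 α Z) (hΔ : 0 < Δ) (s : ℤ → ℤˣ) :
    measureOfCdf (projF Δ s Z) = projAc Δ s Z + projSing Δ Z := by
  obtain ⟨hfin, hcdf⟩ := cdfLeft_measureOfCdf_projF hZ hΔ s
  have := isFiniteMeasure_projAc hZ.1 hΔ s
  have := isFiniteMeasure_projSing (Δ := Δ) hZ.1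
  have hcdf2 : ∀ x, cdfLeft (projAc Δ s Z + projSing Δ Z) x = projF Δ s Z x := fun x => by
    rw [projF, ← cdfLeft_projAc hZ.1 hΔ, ← cdfLeft_projSing hΔ]
    simp only [cdfLeft]
    rw [measureReal_add_apply]
  refine Measure.ext_of_Ico _ _ fun a b hab => ?_
  rw [← measureReal_eq_measureReal_iff, ← cdfLeft_sub _ hab.le, ← cdfLeft_sub _ hab.le, hcdf, hcdf,
    hcdf2, hcdf2]

lemma acPart_add_singPart (μ : Measure ℝ) [IsFiniteMeasure μ] : acPart μ + singPart μ = μ := by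
  rw [add_comm]; exact (Measure.haveLebesgueDecomposition_add μ volume).symm

lemma measureOfCdf_projF_univ (hZ : MemD0 α Z) (hΔ : 0 < Δ) (s : ℤ → ℤˣ) :
    measureOfCdf (projF Δ s Z) univ = Z.μ univ := by
  have := hZ.1.finite_μ
  conv_rhs => rw [← acPart_add_singPart Z.μ]
  rw [measureOfCdf_projF hZ hΔ, Measure.add_apply, Measure.add_apply, projAc_univ hZ.1 hΔ, projSing,
    Measure.map_apply (measurable_gridFloor Δ) MeasurableSet.univ, preimage_univ]

lemma memLp_slopeFun (hZ : MemD α Z) (hΔ : 0 < Δ) (s : ℤ → ℤˣ) :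
    MemLp (slopeFun Δ s Z) 2 volume := by
  have := isFiniteMeasure_projAc hZ hΔ s
  refine (memLp_two_iff_integrable_sq (measurable_slopeFun Δ s Z).aestronglyMeasurable).2
    ⟨((measurable_slopeFun Δ s Z).pow_const 2).aestronglyMeasurable, ?_⟩
  rw [hasFiniteIntegral_iff_ofReal (Eventually.of_forall fun x => sq_nonneg _)]
  have h := measure_lt_top (projAc Δ s Z) univ
  rwa [projAc, withDensity_apply _ MeasurableSet.univ, Measure.restrict_univ] at h

end Measures

section Function

variable {Δ : ℝ} {s : ℤ → ℤˣ} {Z : EulerData} {α : ℝ}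

lemma integral_slopeFun_left (hΔ : 0 < Δ) {j : ℤ} {y : ℝ} (h1 : grid Δ (2 * j) ≤ y)
    (hy : y ≤ grid Δ (2 * j + 1)) :
    ∫ x in grid Δ (2 * j)..y, slopeFun Δ s Z x = slopeL Δ s Z j * (y - grid Δ (2 * j)) := by
  rw [intervalIntegral.integral_of_le h1, ← integral_Ico_eq_integral_Ioc,
    setIntegral_congr_fun (g := fun _ => slopeL Δ s Z j) measurableSet_Ico
      fun x hx => slopeFun_eq_left hΔ hx.1 (hx.2.trans_le hy)]
  rw [setIntegral_const, Real.volume_real_Ico_of_le h1, smul_eq_mul, mul_comm]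

lemma integral_slopeFun_right (hΔ : 0 < Δ) {j : ℤ} {y : ℝ} (h1 : grid Δ (2 * j + 1) ≤ y)
    (hy : y ≤ grid Δ (2 * j + 2)) :
    ∫ x in grid Δ (2 * j + 1)..y, slopeFun Δ s Z x
      = slopeR Δ s Z j * (y - grid Δ (2 * j + 1)) := by
  rw [intervalIntegral.integral_of_le h1, ← integral_Ico_eq_integral_Ioc,
    setIntegral_congr_fun (g := fun _ => slopeR Δ s Z j) measurableSet_Ico
      fun x hx => slopeFun_eq_right hΔ hx.1 (hx.2.trans_le hy)]
  rw [setIntegral_const, Real.volume_real_Ico_of_le h1, smul_eq_mul, mul_comm]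

lemma projU_grid (hΔ : 0 < Δ) (j : ℤ) : projU Δ s Z (grid Δ (2 * j)) = Z.u (grid Δ (2 * j)) := by
  have e : grid Δ (2 * (j - 1) + 2) = grid Δ (2 * j) := by congr 1; ring
  have h := cellIdx_eq hΔ (j := j - 1) (x := grid Δ (2 * j))
    (grid_even_strictMono hΔ (by omega)) e.ge
  simp only [projU, h, e]
  rw [if_neg, sub_self, mul_zero, add_zero]
  have := grid_even_succ Δ (j - 1)
  rw [e] at this
  rw [grid_odd]; linarith

lemma projU_sub_cell (hZ : MemD α Z) (hΔ : 0 < Δ) {j : ℤ} {x : ℝ} (h1 : grid Δ (2 * j) ≤ x)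
    (h2 : x ≤ grid Δ (2 * j + 2)) :
    projU Δ s Z x - Z.u (grid Δ (2 * j)) = ∫ t in grid Δ (2 * j)..x, slopeFun Δ s Z t := by
  rcases h1.eq_or_lt with rfl | h1
  · rw [projU_grid hΔ]; simp
  have hj := cellIdx_eq hΔ h1 h2
  simp only [projU, hj]
  split_ifs with hc
  · rw [integral_slopeFun_left hΔ h1.le hc]; ring
  · have hc := (not_le.1 hc).le
    have hl : LocallyIntegrable (slopeFun Δ s Z) volume :=
      (memLp_slopeFun hZ hΔ s).locallyIntegrable (by norm_num)
    have hi : ∀ a b, IntervalIntegrable (slopeFun Δ s Z) volume a b := fun a b =>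
      (hl.integrableOn_isCompact isCompact_uIcc).intervalIntegrable
    rw [← intervalIntegral.integral_add_adjacent_intervals (hi _ (grid Δ (2 * j + 1))) (hi _ _),
      integral_slopeFun_left hΔ (by rw [grid_odd]; linarith) le_rfl,
      integral_slopeFun_right hΔ hc h2]
    have := diffQ_mul hΔ Z.u j
    simp only [slopeL, slopeR]
    rw [grid_odd, grid_even_succ] at *
    linear_combination -this

/-- The projected function is a primitive of its slopes: by the choice of the slopes it matches
`u` at both end points of every double cell, so that it differs from the primitive by a constant. -/
lemma projU_sub (hZ : MemD α Z) (hΔ : 0 < Δ) (a b : ℝ) :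
    projU Δ s Z b - projU Δ s Z a = ∫ x in a..b, slopeFun Δ s Z x := by
  have hl : LocallyIntegrable (slopeFun Δ s Z) volume :=
    (memLp_slopeFun hZ hΔ s).locallyIntegrable (by norm_num)
  have hi : ∀ a b, IntervalIntegrable (slopeFun Δ s Z) volume a b := fun a b =>
    (hl.integrableOn_isCompact isCompact_uIcc).intervalIntegrable
  set D : ℝ → ℝ := fun x => projU Δ s Z x - ∫ t in (0 : ℝ)..x, slopeFun Δ s Z t with hD
  have hcell : ∀ (j : ℤ) (x : ℝ), grid Δ (2 * j) ≤ x → x ≤ grid Δ (2 * j + 2) →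
      D x = D (grid Δ (2 * j)) := fun j x h1 h2 => by
    have h := projU_sub_cell (s := s) hZ hΔ h1 h2
    have h' := intervalIntegral.integral_add_adjacent_intervals (hi 0 (grid Δ (2 * j))) (hi _ x)
    simp only [hD, projU_grid hΔ]
    linarith
  -- hence `D` takes the same value at all even grid points, and then everywhere
  have hstep : ∀ j : ℤ, D (grid Δ (2 * (j + 1))) = D (grid Δ (2 * j)) := fun j => by
    have e : grid Δ (2 * (j + 1)) = grid Δ (2 * j + 2) := by congr 1; ring
    rw [e]
    exact hcell j _ (by rw [grid_even_succ]; linarith) le_rfl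
  have hgrid : ∀ j : ℤ, D (grid Δ (2 * j)) = D (grid Δ (2 * 0)) := fun j => by
    induction j with
    | zero => rfl
    | succ i ih => rw [hstep, ih]
    | pred i ih => rw [← ih, ← hstep]; congr 2; ring
  have hconst : ∀ x, D x = D (grid Δ (2 * 0)) := fun x => by
    obtain ⟨h1, h2⟩ := mem_cellIdx hΔ x
    rw [hcell _ x h1.le h2, hgrid]
  have h1 := (hconst b).trans (hconst a).symm
  have h2 := intervalIntegral.integral_add_adjacent_intervals (hi 0 a) (hi a b)
  simp only [hD] at h1
  linarith

end Function

/-! ### Energy data of the original and of the projected triplet -/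

variable {Δ : ℝ} {Z : EulerData} {α : ℝ}

lemma exists_isEnergyDatum (hZ : MemD α Z) :
    ∃ N, IsEnergyDatum Z.u (deriv Z.u) Z.μ (singPart Z.μ) N := by
  have := hZ.finite_μ
  obtain ⟨S, hS, h1, h2⟩ := Measure.mutuallySingular_singularPart Z.μ volume
  refine ⟨Sᶜ, hZ.finite_μ, measurable_deriv _, hS.compl, h2, by rwa [compl_compl], ?_,
    hZ.u_mem.sub_eq_integral_deriv⟩
  conv_lhs => rw [← acPart_add_singPart Z.μ, hZ.ac_eq]
  rfl

lemma exists_isEnergyDatum_project (hZ : MemD0 α Z) (hΔ : 0 < Δ) (s : ℤ → ℤˣ) :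
    ∃ N, IsEnergyDatum (projU Δ s Z) (slopeFun Δ s Z) (measureOfCdf (projF Δ s Z))
      (projSing Δ Z) N := by
  have hc : (range fun j : ℤ => grid Δ (2 * j)).Countable := countable_range _
  refine ⟨_, (cdfLeft_measureOfCdf_projF hZ hΔ s).1, measurable_slopeFun _ _ _, hc.measurableSet,
    hc.measure_zero _, ?_, measureOfCdf_projF hZ hΔ s, projU_sub hZ.1 hΔ⟩
  rw [projSing, Measure.map_apply (measurable_gridFloor Δ) hc.measurableSet.compl]
  convert measure_empty (μ := singPart Z.μ)
  ext x; simp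

lemma integral_sq_eq_of_withDensity {w : ℝ → ℝ} (hw : Measurable w) :
    ∫ x, w x ^ 2 = (volume.withDensity fun x => ENNReal.ofReal (w x ^ 2)).real univ := by
  rw [integral_eq_lintegral_of_nonneg_ae (Eventually.of_forall fun x => sq_nonneg _)
    (hw.pow_const 2).aestronglyMeasurable, measureReal_def, withDensity_apply _ MeasurableSet.univ,
    Measure.restrict_univ]

lemma integral_sq_slopeFun (hZ : MemD α Z) (hΔ : 0 < Δ) (s : ℤ → ℤˣ) :
    ∫ x, slopeFun Δ s Z x ^ 2 = ∫ x, deriv Z.u x ^ 2 := by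
  have h := projAc_univ hZ hΔ s
  rw [hZ.ac_eq] at h
  rw [integral_sq_eq_of_withDensity (measurable_slopeFun Δ s Z),
    integral_sq_eq_of_withDensity (measurable_deriv Z.u), measureReal_def, measureReal_def]
  exact congrArg ENNReal.toReal h

/-! ### Convergence of the slopes and of the regularized energy -/

lemma average_closedBall_eq (hΔ : 0 < Δ) (f : ℝ → ℝ) (j : ℤ) :
    ⨍ y in Metric.closedBall (grid Δ (2 * j + 1)) Δ, f y
      = (∫ y in grid Δ (2 * j)..grid Δ (2 * j + 2), f y) / (2 * Δ) := by
  have e1 : grid Δ (2 * j + 1) - Δ = grid Δ (2 * j) := by rw [grid_odd]; ring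
  have e2 : grid Δ (2 * j + 1) + Δ = grid Δ (2 * j + 2) := by rw [grid_odd, grid_even_succ]; ring
  have hle : grid Δ (2 * j) ≤ grid Δ (2 * j + 2) := by rw [grid_even_succ]; linarith
  rw [Real.closedBall_eq_Icc, e1, e2, setAverage_eq, intervalIntegral.integral_of_le hle,
    ← integral_Icc_eq_integral_Ioc, Real.volume_real_Icc_of_le hle, grid_even_succ,
    add_sub_cancel_left, smul_eq_mul, inv_mul_eq_div]

lemma cdfLeft_acPart_sub (hZ : MemD α Z) {a b : ℝ} (hab : a ≤ b) :
    cdfLeft (acPart Z.μ) b - cdfLeft (acPart Z.μ) a = ∫ x in a..b, deriv Z.u x ^ 2 := by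
  have := isFiniteMeasure_acPart hZ
  rw [cdfLeft_sub _ hab, hZ.ac_eq, energy, measureReal_def, withDensity_apply _ measurableSet_Ico,
    intervalIntegral.integral_of_le hab, ← integral_Ico_eq_integral_Ioc,
    integral_eq_lintegral_of_nonneg_ae (Eventually.of_forall fun x => sq_nonneg _)
      ((measurable_deriv Z.u).pow_const 2).aestronglyMeasurable]

/-- By Lebesgue differentiation the difference quotients of `u` and `F_ac` converge to `u_x` and
`u_x²`, so that the perturbation `q` of the slopes vanishes in the limit. -/
lemma tendsto_slopeFun_ae (hZ : MemD α Z) (s : ℝ → ℤ → ℤˣ) :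
    ∀ᵐ x ∂volume, Tendsto (fun Δ => slopeFun Δ (s Δ) Z x) (𝓝[>] 0) (𝓝 (deriv Z.u x)) := by
  obtain ⟨N, hd⟩ := exists_isEnergyDatum hZ
  have L1 := IsUnifLocDoublingMeasure.ae_tendsto_average volume hd.locallyIntegrable_w 1
  have L2 := IsUnifLocDoublingMeasure.ae_tendsto_average volume hd.integrable_sq.locallyIntegrable 1
  filter_upwards [L1, L2] with x h1 h2
  have hmem : ∀ᶠ Δ : ℝ in 𝓝[>] 0,
      x ∈ Metric.closedBall (grid Δ (2 * ⌊x / (2 * Δ)⌋ + 1)) (1 * id Δ) := by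
    filter_upwards [self_mem_nhdsWithin] with Δ (hΔ : 0 < Δ)
    obtain ⟨h3, h4⟩ := mem_of_floor_eq hΔ (rfl : ⌊x / (2 * Δ)⌋ = ⌊x / (2 * Δ)⌋)
    rw [grid_even_succ] at h4
    rw [one_mul, id, Real.closedBall_eq_Icc, grid_odd]
    constructor <;> linarith
  have t1 : Tendsto (fun Δ => diffQ Δ Z.u ⌊x / (2 * Δ)⌋) (𝓝[>] 0) (𝓝 (deriv Z.u x)) := by
    refine (h1 _ id tendsto_id hmem).congr' ?_
    filter_upwards [self_mem_nhdsWithin] with Δ (hΔ : 0 < Δ)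
    rw [id, average_closedBall_eq hΔ, ← hd.sub_eq, diffQ]
  have t2 : Tendsto (fun Δ => diffQ Δ (cdfLeft (acPart Z.μ)) ⌊x / (2 * Δ)⌋) (𝓝[>] 0)
      (𝓝 (deriv Z.u x ^ 2)) := by
    refine (h2 _ id tendsto_id hmem).congr' ?_
    filter_upwards [self_mem_nhdsWithin] with Δ (hΔ : 0 < Δ)
    rw [id, average_closedBall_eq hΔ, ← cdfLeft_acPart_sub hZ (by rw [grid_even_succ]; linarith),
      diffQ]
  have t3 : Tendsto (fun Δ => qCoef Δ Z ⌊x / (2 * Δ)⌋) (𝓝[>] 0) (𝓝 0) := by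
    have := (t2.sub (t1.pow 2)).sqrt
    rwa [sub_self, Real.sqrt_zero] at this
  have t4 : Tendsto (fun Δ => slopeFun Δ (s Δ) Z x - diffQ Δ Z.u ⌊x / (2 * Δ)⌋) (𝓝[>] 0) (𝓝 0) := by
    refine squeeze_zero_norm (fun Δ => ?_) t3
    have hs : |(((s Δ ⌊x / (2 * Δ)⌋ : ℤˣ) : ℤ) : ℝ)| = 1 := by
      rcases Int.units_eq_one_or (s Δ ⌊x / (2 * Δ)⌋) with h | h <;> simp [h]
    have hq : 0 ≤ qCoef Δ Z ⌊x / (2 * Δ)⌋ := Real.sqrt_nonneg _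
    rw [Real.norm_eq_abs, slopeFun]
    split_ifs
    · rw [slopeL, sub_sub_cancel_left, abs_neg, abs_mul, hs, one_mul, abs_of_nonneg hq]
    · rw [slopeR, add_sub_cancel_left, abs_mul, hs, one_mul, abs_of_nonneg hq]
  simpa using t4.add t1

lemma abs_regularized_sub_le (a b : ℝ) :
    |a ^ 2 / (1 + a ^ 2) - b ^ 2 / (1 + b ^ 2)| ≤ |a ^ 2 - b ^ 2| := by
  have e : a ^ 2 / (1 + a ^ 2) - b ^ 2 / (1 + b ^ 2)
      = (a ^ 2 - b ^ 2) / ((1 + a ^ 2) * (1 + b ^ 2)) := by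
    field_simp; ring
  rw [e, abs_div, abs_of_pos (a := (1 + a ^ 2) * (1 + b ^ 2)) (by positivity)]
  have := mul_nonneg (sq_nonneg a) (sq_nonneg b)
  exact div_le_self (abs_nonneg _) (by nlinarith [sq_nonneg a, sq_nonneg b])

lemma integrable_regularized {w : ℝ → ℝ} (hw : Measurable w)
    (hi : Integrable fun x => w x ^ 2) : Integrable fun x => w x ^ 2 / (1 + w x ^ 2) := by
  refine hi.mono (Measurable.aestronglyMeasurable (by fun_prop)) (Eventually.of_forall fun x => ?_)
  rw [Real.norm_of_nonneg (by positivity), Real.norm_of_nonneg (by positivity)]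
  exact div_le_self (sq_nonneg _) (by linarith [sq_nonneg (w x)])

/-- A Scheffé argument: pointwise convergence and convergence of `∫ w²` give `L¹` convergence of
`w²`, hence convergence of the regularized energies. -/
lemma tendsto_regEnergy {ι : Type*} {l : Filter ι} [l.IsCountablyGenerated] {W : ι → ℝ → ℝ}
    {w : ℝ → ℝ} (hW : ∀ i, Measurable (W i)) (hw : Measurable w)
    (hWi : ∀ᶠ i in l, Integrable fun x => W i x ^ 2) (hwi : Integrable fun x => w x ^ 2)
    (hlim : ∀ᵐ x ∂volume, Tendsto (fun i => W i x) l (𝓝 (w x)))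
    (hint : Tendsto (fun i => ∫ x, W i x ^ 2) l (𝓝 (∫ x, w x ^ 2))) :
    Tendsto (fun i => regEnergy (W i)) l (𝓝 (regEnergy w)) := by
  have imin : ∀ i, Integrable fun x => min (W i x ^ 2) (w x ^ 2) := fun i => by
    have := hW i
    refine hwi.mono (Measurable.aestronglyMeasurable (by fun_prop))
      (Eventually.of_forall fun x => ?_)
    rw [Real.norm_of_nonneg (by positivity), Real.norm_of_nonneg (by positivity)]
    exact min_le_right _ _
  have hmin : Tendsto (fun i => ∫ x, min (W i x ^ 2) (w x ^ 2)) l (𝓝 (∫ x, w x ^ 2)) := by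
    refine tendsto_integral_filter_of_dominated_convergence (fun x => w x ^ 2)
      (Eventually.of_forall fun i => (imin i).1) (Eventually.of_forall fun i =>
        Eventually.of_forall fun x => ?_) hwi ?_
    · rw [Real.norm_of_nonneg (by positivity)]
      exact min_le_right _ _
    · filter_upwards [hlim] with x hx
      have h := (hx.pow 2).min (tendsto_const_nhds (x := w x ^ 2))
      rwa [min_self] at h
  have hL1 : Tendsto (fun i => ∫ x, |W i x ^ 2 - w x ^ 2|) l (𝓝 0) := by
    have h := (hint.add_const (∫ x, w x ^ 2)).sub (hmin.const_mul 2)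
    have e0 : ((∫ x, w x ^ 2) + ∫ x, w x ^ 2) - 2 * (∫ x, w x ^ 2) = 0 := by ring
    rw [e0] at h
    refine h.congr' ?_
    filter_upwards [hWi] with i hi
    have iadd : Integrable fun x => W i x ^ 2 + w x ^ 2 := hi.add hwi
    rw [← integral_add hi hwi, ← integral_const_mul, ← integral_sub iadd ((imin i).const_mul 2)]
    refine integral_congr_ae (Eventually.of_forall fun x => ?_)
    change W i x ^ 2 + w x ^ 2 - 2 * min (W i x ^ 2) (w x ^ 2) = |W i x ^ 2 - w x ^ 2|
    rcases le_total (W i x ^ 2) (w x ^ 2) with hc | hc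
    · rw [min_eq_left hc, abs_of_nonpos (by linarith)]; ring
    · rw [min_eq_right hc, abs_of_nonneg (by linarith)]; ring
  rw [tendsto_iff_dist_tendsto_zero]
  refine squeeze_zero' (Eventually.of_forall fun i => dist_nonneg) ?_ hL1
  filter_upwards [hWi] with i hi
  rw [Real.dist_eq, regEnergy, regEnergy, ← integral_sub (integrable_regularized (hW i) hi)
    (integrable_regularized hw hwi)]
  refine abs_integral_le_integral_abs.trans (integral_mono_of_nonneg
    (Eventually.of_forall fun x => abs_nonneg _) (hi.sub hwi).abs
    (Eventually.of_forall fun x => abs_regularized_sub_le _ _))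

lemma tendsto_regEnergy_slopeFun (hZ : MemD α Z) (s : ℝ → ℤ → ℤˣ) :
    Tendsto (fun Δ => regEnergy (slopeFun Δ (s Δ) Z)) (𝓝[>] 0) (𝓝 (regEnergy (deriv Z.u))) := by
  obtain ⟨N, hd⟩ := exists_isEnergyDatum hZ
  refine tendsto_regEnergy (fun Δ => measurable_slopeFun _ _ _) hd.measurable_w ?_ hd.integrable_sq
    (tendsto_slopeFun_ae hZ s) (tendsto_const_nhds.congr' ?_)
  · filter_upwards [self_mem_nhdsWithin] with Δ (hΔ : 0 < Δ)
    exact (memLp_slopeFun hZ hΔ (s Δ)).integrable_sq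
  · filter_upwards [self_mem_nhdsWithin] with Δ (hΔ : 0 < Δ)
    exact (integral_sq_slopeFun hZ hΔ (s Δ)).symm

/-! ### Pointwise convergence in Lagrangian coordinates -/

lemma cdfLeft_measureOfCdf_grid (hZ : MemD0 α Z) (hΔ : 0 < Δ) (s : ℤ → ℤˣ) (j : ℤ) :
    cdfLeft (measureOfCdf (projF Δ s Z)) (grid Δ (2 * j)) = cdfLeft Z.μ (grid Δ (2 * j)) := by
  have := hZ.1.finite_μ
  have := isFiniteMeasure_acPart hZ.1
  have : IsFiniteMeasure (singPart Z.μ) :=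
    isFiniteMeasure_of_le _ (Measure.singularPart_le _ _)
  have e : grid Δ (2 * (j - 1) + 2) = grid Δ (2 * j) := by congr 1; ring
  have h := cellIdx_eq hΔ (j := j - 1) (x := grid Δ (2 * j))
    (grid_even_strictMono hΔ (by omega)) e.ge
  rw [(cdfLeft_measureOfCdf_projF hZ hΔ s).2, projF, ← cdfLeft_projAc hZ.1 hΔ,
    cdfLeft_projAc_grid hZ.1 hΔ, projFsing, h, e]
  conv_rhs => rw [← acPart_add_singPart Z.μ]
  simp only [cdfLeft]
  rw [measureReal_add_apply]

/-- Since the distribution functions agree at the even grid points, both characteristics are within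
two double cells of a common grid point. -/
lemma exists_grid_near_charY (hZ : MemD0 α Z) (hΔ : 0 < Δ) (s : ℤ → ℤˣ) (ξ : ℝ) :
    ∃ j : ℤ, |charY Z.μ ξ - grid Δ (2 * j)| ≤ 4 * Δ ∧
      |charY (measureOfCdf (projF Δ s Z)) ξ - grid Δ (2 * j)| ≤ 4 * Δ := by
  have := hZ.1.finite_μ
  have := (cdfLeft_measureOfCdf_projF hZ hΔ s).1
  obtain ⟨h1, h2⟩ := mem_cellIdx hΔ (charY Z.μ ξ)
  set j := cellIdx Δ (charY Z.μ ξ)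
  have e1 := grid_even_succ Δ j
  have e2 : grid Δ (2 * (j + 2)) = grid Δ (2 * j) + 4 * Δ := by
    simp only [grid]; push_cast; ring
  have h3 : grid Δ (2 * j) ≤ charY (measureOfCdf (projF Δ s Z)) ξ := by
    refine le_charY ?_
    rw [cdfLeft_measureOfCdf_grid hZ hΔ]
    by_contra hc
    exact absurd (charY_le (not_lt.1 hc)) (not_le.2 h1)
  have h4 : charY (measureOfCdf (projF Δ s Z)) ξ ≤ grid Δ (2 * (j + 2)) := by
    refine charY_le ?_
    rw [cdfLeft_measureOfCdf_grid hZ hΔ]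
    by_contra hc
    linarith [le_charY (not_le.1 hc)]
  refine ⟨j, ?_, ?_⟩ <;> rw [abs_of_nonneg (by linarith)] <;> linarith

lemma tendsto_charY (hZ : MemD0 α Z) (s : ℝ → ℤ → ℤˣ) (ξ : ℝ) :
    Tendsto (fun Δ => charY (measureOfCdf (projF Δ (s Δ) Z)) ξ) (𝓝[>] 0) (𝓝 (charY Z.μ ξ)) := by
  rw [tendsto_iff_dist_tendsto_zero]
  have h0 : Tendsto (fun Δ : ℝ => 8 * Δ) (𝓝[>] 0) (𝓝 0) := by
    have : Tendsto (fun Δ : ℝ => 8 * Δ) (𝓝 0) (𝓝 (8 * 0)) := (continuous_const_mul 8).tendsto 0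
    rw [mul_zero] at this
    exact this.mono_left nhdsWithin_le_nhds
  refine squeeze_zero' (Eventually.of_forall fun i => dist_nonneg) ?_ h0
  filter_upwards [self_mem_nhdsWithin] with Δ (hΔ : 0 < Δ)
  obtain ⟨j, h1, h2⟩ := exists_grid_near_charY hZ hΔ (s Δ) ξ
  rw [Real.dist_eq]
  rw [abs_le] at h1 h2 ⊢
  constructor <;> linarith [h1.1, h1.2, h2.1, h2.2]

/-- Hölder continuity of exponent `1/2` for primitives of square integrable functions. -/
lemma abs_sub_le_of_primitive {P w : ℝ → ℝ} (hw : MemLp w 2 volume)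
    (h : ∀ a b, P b - P a = ∫ x in a..b, w x) {δ : ℝ} (hδ : 0 < δ) {a b : ℝ} (hab : |b - a| ≤ δ) :
    |P b - P a| ≤ √δ * (1 + ∫ x, w x ^ 2) := by
  set r := √δ with hr
  have hr0 : 0 < r := Real.sqrt_pos.2 hδ
  have hrr : r * r = δ := Real.mul_self_sqrt hδ.le
  have isq := hw.integrable_sq
  rw [h a b]
  refine (intervalIntegral.norm_integral_le_integral_norm_uIoc (f := w)).trans ?_
  have hfin : volume (Set.uIoc a b) ≠ ⊤ := by rw [Real.volume_uIoc]; exact ENNReal.ofReal_ne_top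
  have i1 : IntegrableOn (fun _ : ℝ => 1 / r) (Set.uIoc a b) := integrableOn_const hfin
  have i2 : IntegrableOn (fun x => r * w x ^ 2) (Set.uIoc a b) := (isq.const_mul r).integrableOn
  have hwi : IntegrableOn w (Set.uIoc a b) := by
    have := hw.locallyIntegrable (by norm_num)
    exact (this.integrableOn_isCompact isCompact_uIcc).mono_set uIoc_subset_uIcc
  -- Young's inequality with the weight `r = √δ` that balances the two terms
  calc ∫ x in Set.uIoc a b, ‖w x‖ ≤ ∫ x in Set.uIoc a b, (1 / r + r * w x ^ 2) := by
        refine integral_mono hwi.norm (i1.add i2) fun x => ?_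
        change ‖w x‖ ≤ 1 / r + r * w x ^ 2
        rw [Real.norm_eq_abs, ← sq_abs (w x)]
        have e : 1 / r + r * |w x| ^ 2 - |w x| = ((1 - r * |w x|) ^ 2 + r * |w x|) / r := by
          field_simp; ring
        have : 0 ≤ ((1 - r * |w x|) ^ 2 + r * |w x|) / r := by positivity
        linarith
    _ = |b - a| / r + r * ∫ x in Set.uIoc a b, w x ^ 2 := by
        rw [integral_add i1 i2, integral_const_mul, setIntegral_const, measureReal_def,
          Real.volume_uIoc, ENNReal.toReal_ofReal (abs_nonneg _), smul_eq_mul, mul_one_div]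
    _ ≤ r + r * ∫ x, w x ^ 2 := by
        refine add_le_add ?_ (mul_le_mul_of_nonneg_left ?_ hr0.le)
        · rw [div_le_iff₀ hr0]; linarith
        · exact setIntegral_le_integral isq (Eventually.of_forall fun x => sq_nonneg _)
    _ = r * (1 + ∫ x, w x ^ 2) := by ring

lemma tendsto_projU_charY (hZ : MemD0 α Z) (s : ℝ → ℤ → ℤˣ) (ξ : ℝ) :
    Tendsto (fun Δ => projU Δ (s Δ) Z (charY (measureOfCdf (projF Δ (s Δ) Z)) ξ)) (𝓝[>] 0)
      (𝓝 (Z.u (charY Z.μ ξ))) := by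
  obtain ⟨N, hd⟩ := exists_isEnergyDatum hZ.1
  set M := ∫ x, deriv Z.u x ^ 2
  rw [tendsto_iff_dist_tendsto_zero]
  have h0 : Tendsto (fun Δ : ℝ => √(4 * Δ) * (1 + M) + √(4 * Δ) * (1 + M)) (𝓝[>] 0) (𝓝 0) := by
    have hc : Continuous fun Δ : ℝ => √(4 * Δ) * (1 + M) + √(4 * Δ) * (1 + M) := by fun_prop
    have := hc.tendsto 0
    simp only [mul_zero, Real.sqrt_zero, zero_mul, add_zero] at this
    exact this.mono_left nhdsWithin_le_nhds
  refine squeeze_zero' (Eventually.of_forall fun i => dist_nonneg) ?_ h0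
  filter_upwards [self_mem_nhdsWithin] with Δ (hΔ : 0 < Δ)
  obtain ⟨j, h1, h2⟩ := exists_grid_near_charY hZ hΔ (s Δ) ξ
  have h4 : 0 < 4 * Δ := by linarith
  have b1 := abs_sub_le_of_primitive hd.memLp_w hd.sub_eq h4 h1
  have b2 := abs_sub_le_of_primitive (memLp_slopeFun hZ.1 hΔ (s Δ)) (projU_sub hZ.1 hΔ) h4 h2
  rw [projU_grid hΔ, integral_sq_slopeFun hZ.1 hΔ] at b2
  rw [Real.dist_eq]
  rw [abs_le] at b1 b2 ⊢
  constructor <;> linarith [b1.1, b1.2, b2.1, b2.2]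

end HunterSaxton

open HunterSaxton in
theorem mainTheorem7 (α : ℝ) (hα : α ∈ Set.Icc (0 : ℝ) 1)
    (Z : EulerData) (hZ : MemD0 α Z) (s : ℝ → ℤ → ℤˣ)
    (X : LagrangeData) (hX : X = toLagrange Z)
    (XΔ : ℝ → LagrangeData) (hXΔ : ∀ Δ : ℝ, XΔ Δ = toLagrange (project Δ (s Δ) Z)) :
    (HasRegularDerivs X ∧ ∀ Δ : ℝ, 0 < Δ → HasRegularDerivs (XΔ Δ)) ∧
    (DerivTendsto 1 (fun Δ => (XΔ Δ).y) X.y ∧ DerivTendsto 2 (fun Δ => (XΔ Δ).y) X.y) ∧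
    DerivTendsto 2 (fun Δ => (XΔ Δ).U) X.U ∧
    (DerivTendsto 1 (fun Δ => (XΔ Δ).H) X.H ∧ DerivTendsto 2 (fun Δ => (XΔ Δ).H) X.H) := by
  obtain ⟨N, hd⟩ := exists_isEnergyDatum hZ.1
  have hZΔ : ∀ Δ : ℝ, 0 < Δ → _ := fun Δ hΔ => exists_isEnergyDatum_project hZ hΔ (s Δ)
  have hfin := hZ.1.finite_μ
  have hX' : X = toLagrange ⟨Z.u, Z.μ, Z.μ⟩ := by
    rw [hX]; simp only [toLagrange, hZ.2]
  obtain rfl : XΔ = fun Δ => toLagrange (project Δ (s Δ) Z) := funext hXΔ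
  subst hX'
  set mΔ : ℝ → Measure ℝ := fun Δ => measureOfCdf (projF Δ (s Δ) Z) with hmΔ
  -- the masses of `m` agree, so the norms of `H_ξ` converge with the regularized energies
  have hHsq : Tendsto (fun Δ => ∫ ξ, (deriv (charH (mΔ Δ)) ξ - deriv (charH Z.μ) ξ) ^ 2)
      (𝓝[>] 0) (𝓝 0) := by
    refine tendsto_integral_sq_deriv_sub ?_ (lipschitzWith_charH _)
      (fun ξ => (tendsto_charY hZ s ξ).const_sub ξ) ?_ hd.memLp_deriv_charH ?_
    · filter_upwards [self_mem_nhdsWithin] with Δ (hΔ : 0 < Δ)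
      have := (hZΔ Δ hΔ).choose_spec.finite
      exact lipschitzWith_charH _
    · filter_upwards [self_mem_nhdsWithin] with Δ (hΔ : 0 < Δ)
      exact (hZΔ Δ hΔ).choose_spec.memLp_deriv_charH
    · rw [hd.integral_sq_deriv_charH]
      refine ((tendsto_regEnergy_slopeFun hZ.1 s).const_sub (Z.μ.real univ)).congr' ?_
      filter_upwards [self_mem_nhdsWithin] with Δ (hΔ : 0 < Δ)
      rw [(hZΔ Δ hΔ).choose_spec.integral_sq_deriv_charH, measureReal_def, measureReal_def,
        measureOfCdf_projF_univ hZ hΔ]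
  have hH2 : DerivTendsto 2 (fun Δ => charH (mΔ Δ)) (charH Z.μ) := by
    refine tendsto_eLpNorm_two_of_integral_sq ?_ hHsq
    filter_upwards [self_mem_nhdsWithin] with Δ (hΔ : 0 < Δ)
    exact (hZΔ Δ hΔ).choose_spec.memLp_deriv_charH.sub hd.memLp_deriv_charH
  have hH1 : DerivTendsto 1 (fun Δ => charH (mΔ Δ)) (charH Z.μ) := by
    refine tendsto_eLpNorm_one_of_integral_sq ?_ hd.integrable_deriv_charH hd.memLp_deriv_charH
      hd.deriv_charH_nonneg_ae (tendsto_const_nhds.congr' ?_) hHsq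
    · filter_upwards [self_mem_nhdsWithin] with Δ (hΔ : 0 < Δ)
      have h := (hZΔ Δ hΔ).choose_spec
      exact ⟨h.integrable_deriv_charH, h.memLp_deriv_charH, h.deriv_charH_nonneg_ae⟩
    · filter_upwards [self_mem_nhdsWithin] with Δ (hΔ : 0 < Δ)
      rw [(hZΔ Δ hΔ).choose_spec.integral_deriv_charH, hd.integral_deriv_charH, measureReal_def,
        measureReal_def, measureOfCdf_projF_univ hZ hΔ]
  have hy : ∀ p, DerivTendsto p (fun Δ => charH (mΔ Δ)) (charH Z.μ) →
      DerivTendsto p (fun Δ => charY (mΔ Δ)) (charY Z.μ) := fun p hp => by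
    refine Tendsto.congr' ?_ hp
    filter_upwards [self_mem_nhdsWithin] with Δ (hΔ : 0 < Δ)
    have h := (hZΔ Δ hΔ).choose_spec
    rw [← eLpNorm_neg]
    refine eLpNorm_congr_ae ?_
    filter_upwards [h.deriv_charH_ae, h.deriv_charY_ae, hd.deriv_charH_ae, hd.deriv_charY_ae]
      with ξ h1 h2 h3 h4
    rw [Pi.neg_apply, h1, h2, h3, h4]; ring
  have hU : DerivTendsto 2 (fun Δ ξ => projU Δ (s Δ) Z (charY (mΔ Δ) ξ))
      (fun ξ => Z.u (charY Z.μ ξ)) := by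
    refine tendsto_eLpNorm_two_of_integral_sq ?_ (tendsto_integral_sq_deriv_sub ?_
      hd.lipschitzWith_comp_charY (tendsto_projU_charY hZ s) ?_ hd.memLp_deriv_comp_charY ?_)
    · filter_upwards [self_mem_nhdsWithin] with Δ (hΔ : 0 < Δ)
      exact (hZΔ Δ hΔ).choose_spec.memLp_deriv_comp_charY.sub hd.memLp_deriv_comp_charY
    · filter_upwards [self_mem_nhdsWithin] with Δ (hΔ : 0 < Δ)
      exact (hZΔ Δ hΔ).choose_spec.lipschitzWith_comp_charY
    · filter_upwards [self_mem_nhdsWithin] with Δ (hΔ : 0 < Δ)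
      exact (hZΔ Δ hΔ).choose_spec.memLp_deriv_comp_charY
    · rw [hd.integral_sq_deriv_comp_charY]
      refine (tendsto_regEnergy_slopeFun hZ.1 s).congr' ?_
      filter_upwards [self_mem_nhdsWithin] with Δ (hΔ : 0 < Δ)
      exact (hZΔ Δ hΔ).choose_spec.integral_sq_deriv_comp_charY.symm
  exact ⟨⟨hd.hasRegularDerivs Z.μ, fun Δ hΔ => (hZΔ Δ hΔ).choose_spec.hasRegularDerivs _⟩,
    ⟨hy 1 hH1, hy 2 hH2⟩, hU, hH1, hH2⟩
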